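/- Let $\mathcal{E}$ be an exact category (an additive category with a class of kernel–cokernel pairs, called conflations, satisfying Quillen's axioms) that is weakly idempotent split, i.e. every retraction in $\mathcal{E}$ has a kernel. Let $\mathcal{P}\subset\mathcal{E}$ be a projectively generating subcategory, i.e. a full additive subcategory consisting of projective objects such that every $E\in\mathcal{E}$ admits a deflation $P\to E$ with $P\in\mathcal{P}$, and assume that $\mathcal{P}$ has weak kernels. Let $i_R\colon\mathcal{E}\to\mathcal{A}_r(\mathcal{E})$ be the right abelian envelope of $\mathcal{E}$: an abelian category with a right exact functor $i_R$ such that, for every abelian category $\mathcal{B}$, composition with $i_R$ is an equivalence from the category of right exact functors $\mathcal{A}_r(\mathcal{E})\to\mathcal{B}$ to the category of right exact functors $\mathcal{E}\to\mathcal{B}$. (An additive functor $F$ from $\mathcal{E}$ to an abelian category is right exact if $F(X)\to F(Y)\to F(Z)\to 0$ is exact for every conflation $X\to Y\to Z$.) For $\sharp\in\{b,-\}$, let $\mathcal{D}^\sharp$ of an exact category be the Verdier quotient of the homotopy category of bounded (for $\sharp=b$), respectively bounded above (for $\sharp=-$), complexes by the acyclic ones; an abelian category is regarded as an exact category whose conflations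 are the short exact sequences. Then $i_R$ is exact, and hence, applied termwise to complexes, it induces functors $Li_R\colon\mathcal{D}^\sharp(\mathcal{E})\to\mathcal{D}^\sharp(\mathcal{A}_r(\mathcal{E}))$ for $\sharp\in\{b,-\}$. Moreover: (i) $Li_R\colon\mathcal{D}^-(\mathcal{E})\to\mathcal{D}^-(\mathcal{A}_r(\mathcal{E}))$ is an equivalence; (ii) if $\mathcal{P}$ is idempotent split and $\mathcal{A}_r(\mathcal{E})$ has finite global dimension, then $Li_R\colon\mathcal{D}^b(\mathcal{E})\to\mathcal{D}^b(\mathcal{A}_r(\mathcal{E}))$ is an equivalence. -/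

import Mathlib

open CategoryTheory CategoryTheory.Limits ZeroObject

universe w w' v v' u u'

/-! ## Exact categories -/

/-- An exact structure (in the sense of Quillen) on an additive category `E`: a class of
kernel-cokernel pairs `X ⟶ Y ⟶ Z`, called conflations, subject to the usual axioms. The first map
of a conflation is an inflation, the second one is a deflation. -/
structure ExactStructure (E : Type u) [Category.{v} E] [Preadditive E] [HasZeroObject E]
    [HasBinaryBiproducts E] where
  /-- the class of conflations -/
  conflation : ShortComplex E → Prop
  of_iso : ∀ {S T : ShortComplex E}, (S ≅ T) → conflation S → conflation T
  isKernel : ∀ {S : ShortComplex E}, conflation S →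
    Nonempty (IsLimit (KernelFork.ofι S.f S.zero))
  isCokernel : ∀ {S : ShortComplex E}, conflation S →
    Nonempty (IsColimit (CokernelCofork.ofπ S.g S.zero))
  zero_id : ∀ X : E, conflation (ShortComplex.mk (0 : (0 : E) ⟶ X) (𝟙 X) zero_comp)
  /-- the composite of two deflations is a deflation -/
  comp_deflation : ∀ {X Y Z : E} (d : X ⟶ Y) (e : Y ⟶ Z),
    (∃ (K : E) (i : K ⟶ X) (h : i ≫ d = 0), conflation (ShortComplex.mk i d h)) →
    (∃ (K : E) (i : K ⟶ Y) (h : i ≫ e = 0), conflation (ShortComplex.mk i e h)) →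
    ∃ (K : E) (i : K ⟶ X) (h : i ≫ d ≫ e = 0), conflation (ShortComplex.mk i (d ≫ e) h)
  /-- the pullback of a deflation along any morphism exists and is a deflation -/
  pullback_deflation : ∀ {Y Z Z' : E} (d : Y ⟶ Z) (f : Z' ⟶ Z),
    (∃ (K : E) (i : K ⟶ Y) (h : i ≫ d = 0), conflation (ShortComplex.mk i d h)) →
    ∃ (Y' : E) (f' : Y' ⟶ Y) (d' : Y' ⟶ Z'), IsPullback f' d' d f ∧
      ∃ (K : E) (i : K ⟶ Y') (h : i ≫ d' = 0), conflation (ShortComplex.mk i d' h)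
  /-- the pushout of an inflation along any morphism exists and is an inflation -/
  pushout_inflation : ∀ {X Y X' : E} (i : X ⟶ Y) (f : X ⟶ X'),
    (∃ (Q : E) (d : Y ⟶ Q) (h : i ≫ d = 0), conflation (ShortComplex.mk i d h)) →
    ∃ (Y' : E) (f' : Y ⟶ Y') (i' : X' ⟶ Y'), IsPushout i f f' i' ∧
      ∃ (Q : E) (d : Y' ⟶ Q) (h : i' ≫ d = 0), conflation (ShortComplex.mk i' d h)

/-- An abelian category, regarded as an exact category: the conflations are the short exact
sequences. -/
def ExactStructure.ofAbelian (A : Type u) [Category.{v} A] [Abelian A] : ExactStructure A where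
  conflation S := S.ShortExact
  of_iso e h := ShortComplex.shortExact_of_iso e h
  isKernel h := ⟨h.fIsKernel⟩
  isCokernel h := ⟨h.gIsCokernel⟩
  zero_id X :=
    { exact := (ShortComplex.exact_iff_mono _ rfl).2 inferInstance
      mono_f := ⟨fun _ _ _ => (isZero_zero A).eq_of_tgt _ _⟩
      epi_g := inferInstanceAs (Epi (𝟙 X)) }
  comp_deflation d e := by
    rintro ⟨_, _, _, hd⟩ ⟨_, _, _, he⟩
    have : Epi d := hd.epi_g
    have : Epi e := he.epi_g
    exact ⟨kernel (d ≫ e), kernel.ι _, kernel.condition _,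
      { exact := ShortComplex.exact_kernel _
        mono_f := inferInstanceAs (Mono (kernel.ι (d ≫ e)))
        epi_g := inferInstanceAs (Epi (d ≫ e)) }⟩
  pullback_deflation d f := by
    rintro ⟨_, _, _, hd⟩
    have : Epi d := hd.epi_g
    exact ⟨pullback d f, pullback.fst d f, pullback.snd d f, IsPullback.of_hasPullback d f,
      kernel (pullback.snd d f), kernel.ι _, kernel.condition _,
      { exact := ShortComplex.exact_kernel _
        mono_f := inferInstanceAs (Mono (kernel.ι (pullback.snd d f)))
        epi_g := inferInstanceAs (Epi (pullback.snd d f)) }⟩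
  pushout_inflation i f := by
    rintro ⟨_, _, _, hi⟩
    have : Mono i := hi.mono_f
    exact ⟨pushout i f, pushout.inl i f, pushout.inr i f, IsPushout.of_hasPushout i f,
      cokernel (pushout.inr i f), cokernel.π _, cokernel.condition _,
      { exact := ShortComplex.exact_cokernel _
        mono_f := inferInstanceAs (Mono (pushout.inr i f))
        epi_g := inferInstanceAs (Epi (cokernel.π (pushout.inr i f))) }⟩

/-- A category is weakly idempotent split if every retraction has a kernel. -/
def IsWeaklyIdempotentSplit (E : Type u) [Category.{v} E] [HasZeroMorphisms E] : Prop :=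
  ∀ ⦃X Y : E⦄ (r : X ⟶ Y) (s : Y ⟶ X), s ≫ r = 𝟙 Y → HasKernel r

namespace ExactStructure

section

variable {E : Type u} [Category.{v} E] [Preadditive E] [HasZeroObject E] [HasBinaryBiproducts E]
  {E' : Type u'} [Category.{v'} E'] [Preadditive E'] [HasZeroObject E'] [HasBinaryBiproducts E']

/-- A morphism is a deflation if it is the second map of a conflation. -/
def IsDeflation (S : ExactStructure E) {Y Z : E} (d : Y ⟶ Z) : Prop :=
  ∃ (X : E) (i : X ⟶ Y) (h : i ≫ d = 0), S.conflation (ShortComplex.mk i d h)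

/-- An exact functor between exact categories: an additive functor that sends conflations to
conflations. -/
structure IsExactFunctor (S : ExactStructure E) (S' : ExactStructure E') (F : E ⥤ E') : Prop where
  additive : F.Additive
  map_conflation : ∀ T : ShortComplex E, S.conflation T → S'.conflation (T.map F)

/-- An object `P` is projective if `Hom(P, -)`, with values in abelian groups, is exact. -/
def IsProjective (S : ExactStructure E) (P : E) : Prop :=
  S.IsExactFunctor (ofAbelian AddCommGrpCat.{v}) (preadditiveCoyoneda.obj (Opposite.op P))

/-- The full subcategory of `E` given by `P` is projectively generating: it is an additive
subcategory, it consists of projective objects and every object of `E` receives a deflation from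
an object of `P`. -/
structure IsProjectivelyGenerating (S : ExactStructure E) (P : ObjectProperty E) : Prop where
  zero : P.isoClosure 0
  biprod : ∀ X Y : E, P X → P Y → P.isoClosure (X ⊞ Y)
  isProjective : ∀ X : E, P X → S.IsProjective X
  exists_deflation : ∀ X : E, ∃ (Q : E) (d : Q ⟶ X), P Q ∧ S.IsDeflation d

end

/-! ## Right exact functors and the right abelian envelope -/

section

variable {E : Type u} [Category.{v} E] [Preadditive E] [HasZeroObject E] [HasBinaryBiproducts E]
  {A : Type u'} [Category.{v'} A] [Abelian A]

/-- A right exact functor from an exact category to an abelian category: an additive functor `F`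
such that `F X ⟶ F Y ⟶ F Z ⟶ 0` is exact for every conflation `X ⟶ Y ⟶ Z`. -/
structure IsRightExact (S : ExactStructure E) (F : E ⥤ A) : Prop where
  additive : F.Additive
  exact : ∀ (T : ShortComplex E), S.conflation T → (T.map F).Exact
  epi : ∀ (T : ShortComplex E), S.conflation T → Epi (F.map T.g)

lemma IsRightExact.comp {S : ExactStructure E} {F : E ⥤ A} (hF : S.IsRightExact F)
    {B : Type w} [Category.{w'} B] [Abelian B] {G : A ⥤ B} (hG : (ofAbelian A).IsRightExact G) :
    S.IsRightExact (F ⋙ G) := by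
  have := hF.additive
  have := hG.additive
  have h₀ : ∀ T : ShortComplex A, T.ShortExact → (T.map G).Exact ∧ Epi (G.map T.g) :=
    fun T hT => ⟨hG.exact T hT, hG.epi T hT⟩
  have h : ∀ T : ShortComplex A, T.Exact ∧ Epi T.g → (T.map G).Exact ∧ Epi (G.map T.g) :=
    ((Functor.preservesFiniteColimits_tfae G).out 0 1).1 h₀
  exact
    { additive := inferInstance
      exact := fun T hT => (h (T.map F) ⟨hF.exact T hT, hF.epi T hT⟩).1
      epi := fun T hT => (h (T.map F) ⟨hF.exact T hT, hF.epi T hT⟩).2 }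

/-- The category of right exact functors from an exact category `E` to an abelian category `B`,
with all natural transformations as morphisms. -/
abbrev Rex (S : ExactStructure E) (B : Type w) [Category.{w'} B] [Abelian B] :=
  ObjectProperty.FullSubcategory (fun F : E ⥤ B => S.IsRightExact F)

/-- Composition with a right exact functor `F : E ⥤ A` into an abelian category, as a functor
from right exact functors `A ⥤ B` to right exact functors `E ⥤ B`. -/
def Rex.precomp (S : ExactStructure E) (F : E ⥤ A) (hF : S.IsRightExact F)
    (B : Type w) [Category.{w'} B] [Abelian B] : (ofAbelian A).Rex B ⥤ S.Rex B :=
  ObjectProperty.lift _ (ObjectProperty.ι _ ⋙ (Functor.whiskeringLeft E A B).obj F)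
    fun G => hF.comp G.property

/-- The abelian category `A` with the functor `F : E ⥤ A` is a right abelian envelope of the exact
category `E`: `F` is right exact and composition with `F` is an equivalence from right exact
functors `A ⥤ B` to right exact functors `E ⥤ B` for all abelian categories `B` (with objects in
`Type w` and morphisms in `Type w'`). -/
structure IsRightAbelianEnvelope (S : ExactStructure E) (F : E ⥤ A) : Prop where
  isRightExact : S.IsRightExact F
  isEquivalence : ∀ (B : Type w) [Category.{w'} B] [Abelian B],
    (Rex.precomp S F isRightExact B).IsEquivalence

end

end ExactStructure

/-- An abelian category has finite global dimension if for some `n` all groups `Ext^i(X, Y)` with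
`i ≥ n` vanish. -/
def HasFiniteGlobalDimension (A : Type u) [Category.{v} A] [Abelian A] : Prop :=
  ∃ n : ℕ, ∀ X : A, HasProjectiveDimensionLT X n

/-! ## Derived categories of exact categories -/

namespace ExactStructure

variable {E : Type u} [Category.{v} E] [Preadditive E] [HasZeroObject E] [HasBinaryBiproducts E]
  {E' : Type u'} [Category.{v'} E'] [Preadditive E'] [HasZeroObject E'] [HasBinaryBiproducts E']

/-- A cochain complex `K` is acyclic if all its differentials factor as
`K n ⟶ Z (n + 1) ⟶ K (n + 1)` in such a way that `Z n ⟶ K n ⟶ Z (n + 1)` are conflations. -/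
def IsAcyclic (S : ExactStructure E) (K : CochainComplex E ℤ) : Prop :=
  ∃ (Z : ℤ → E) (i : ∀ n, Z n ⟶ K.X n) (p : ∀ n, K.X n ⟶ Z (n + 1)) (h : ∀ n, i n ≫ p n = 0),
    (∀ n, S.conflation (ShortComplex.mk (i n) (p n) (h n))) ∧
      ∀ n, K.d n (n + 1) = p n ≫ i (n + 1)

/-- The class of acyclic complexes in the homotopy category. -/
def acyclic (S : ExactStructure E) : ObjectProperty (HomotopyCategory E (ComplexShape.up ℤ)) :=
  fun K => S.IsAcyclic K.as

/-- For a class `𝒦` of complexes, viewed as a full subcategory of the homotopy category, the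
morphisms in `𝒦` whose cone is homotopy equivalent to an acyclic complex belonging to `𝒦`. -/
def acyclicCone (S : ExactStructure E)
    (𝒦 : ObjectProperty (HomotopyCategory E (ComplexShape.up ℤ))) :
    MorphismProperty 𝒦.FullSubcategory :=
  (𝒦 ⊓ S.acyclic).trW.inverseImage 𝒦.ι

lemma IsExactFunctor.map_isAcyclic {S : ExactStructure E} {S' : ExactStructure E'} {F : E ⥤ E'}
    [F.Additive] (hF : S.IsExactFunctor S' F) {K : CochainComplex E ℤ} (hK : S.IsAcyclic K) :
    S'.IsAcyclic ((F.mapHomologicalComplex (ComplexShape.up ℤ)).obj K) := by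
  obtain ⟨Z, i, p, h, hc, hd⟩ := hK
  refine ⟨fun n => F.obj (Z n), fun n => F.map (i n), fun n => F.map (p n),
    fun n => (F.map_comp _ _).symm.trans ((congrArg F.map (h n)).trans (F.map_zero _ _)),
    fun n => hF.map_conflation _ (hc n),
    fun n => (congrArg F.map (hd n)).trans (F.map_comp _ _)⟩

/-- A functor that preserves acyclicity and maps the class `𝒦` to the class `𝒦'` induces a
morphism of localization data. -/
def IsExactFunctor.localizerMorphism {S : ExactStructure E} {S' : ExactStructure E'} {F : E ⥤ E'}
    [F.Additive] (hF : S.IsExactFunctor S' F)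
    {𝒦 : ObjectProperty (HomotopyCategory E (ComplexShape.up ℤ))}
    {𝒦' : ObjectProperty (HomotopyCategory E' (ComplexShape.up ℤ))}
    (h : ∀ K, 𝒦 K → 𝒦' ((F.mapHomotopyCategory (ComplexShape.up ℤ)).obj K)) :
    LocalizerMorphism (S.acyclicCone 𝒦) (S'.acyclicCone 𝒦') where
  functor := 𝒦'.lift (𝒦.ι ⋙ F.mapHomotopyCategory (ComplexShape.up ℤ)) fun K => h _ K.property
  map := by
    rintro K L f hf
    obtain ⟨C, a, b, hT, hC, hC'⟩ := hf
    exact ⟨_, _, _, (F.mapHomotopyCategory (ComplexShape.up ℤ)).map_distinguished _ hT,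
      h _ hC, hF.map_isAcyclic hC'⟩

end ExactStructure

section

variable (E : Type u) [Category.{v} E] [Preadditive E]

/-- The complexes `K` with `K n = 0` for all `n` outside a bounded interval, as objects of the
homotopy category. -/
def boundedComplexes : ObjectProperty (HomotopyCategory E (ComplexShape.up ℤ)) :=
  fun K => ∃ a b : ℤ, ∀ n : ℤ, n < a ∨ b < n → IsZero (K.as.X n)

/-- The (cochain) complexes `K` with `K n = 0` for all large `n`, as objects of the homotopy
category. -/
def boundedAboveComplexes : ObjectProperty (HomotopyCategory E (ComplexShape.up ℤ)) :=
  fun K => ∃ b : ℤ, ∀ n : ℤ, b < n → IsZero (K.as.X n)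

variable {E} {E' : Type u'} [Category.{v'} E'] [Preadditive E']

lemma boundedComplexes_map (F : E ⥤ E') [F.Additive]
    (K : HomotopyCategory E (ComplexShape.up ℤ)) (hK : boundedComplexes E K) :
    boundedComplexes E' ((F.mapHomotopyCategory (ComplexShape.up ℤ)).obj K) := by
  obtain ⟨a, b, h⟩ := hK
  exact ⟨a, b, fun n hn => F.map_isZero (h n hn)⟩

lemma boundedAboveComplexes_map (F : E ⥤ E') [F.Additive]
    (K : HomotopyCategory E (ComplexShape.up ℤ)) (hK : boundedAboveComplexes E K) :
    boundedAboveComplexes E' ((F.mapHomotopyCategory (ComplexShape.up ℤ)).obj K) := by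
  obtain ⟨b, h⟩ := hK
  exact ⟨b, fun n hn => F.map_isZero (h n hn)⟩

end

namespace ExactStructure

variable {E : Type u} [Category.{v} E] [Preadditive E] [HasZeroObject E] [HasBinaryBiproducts E]
  {E' : Type u'} [Category.{v'} E'] [Preadditive E'] [HasZeroObject E'] [HasBinaryBiproducts E']

/-- The bounded derived category of an exact category: the Verdier quotient of the homotopy
category of bounded complexes by the bounded acyclic complexes, that is, its localization at the
morphisms whose cone is homotopy equivalent to a bounded acyclic complex. -/
abbrev BoundedDerivedCategory (S : ExactStructure E) :=
  (S.acyclicCone (boundedComplexes E)).Localization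

/-- The bounded above derived category of an exact category: the Verdier quotient of the homotopy
category of bounded above complexes by the bounded above acyclic complexes. -/
abbrev BoundedAboveDerivedCategory (S : ExactStructure E) :=
  (S.acyclicCone (boundedAboveComplexes E)).Localization

/-- The functor between bounded derived categories that is induced by applying an exact functor
termwise to complexes. -/
noncomputable def IsExactFunctor.mapBoundedDerivedCategory {S : ExactStructure E}
    {S' : ExactStructure E'} {F : E ⥤ E'} (hF : S.IsExactFunctor S' F) :
    S.BoundedDerivedCategory ⥤ S'.BoundedDerivedCategory :=
  haveI := hF.additive
  (hF.localizerMorphism (boundedComplexes_map F)).localizedFunctor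
    (S.acyclicCone (boundedComplexes E)).Q (S'.acyclicCone (boundedComplexes E')).Q

/-- The functor between bounded above derived categories that is induced by applying an exact
functor termwise to complexes. -/
noncomputable def IsExactFunctor.mapBoundedAboveDerivedCategory {S : ExactStructure E}
    {S' : ExactStructure E'} {F : E ⥤ E'} (hF : S.IsExactFunctor S' F) :
    S.BoundedAboveDerivedCategory ⥤ S'.BoundedAboveDerivedCategory :=
  haveI := hF.additive
  (hF.localizerMorphism (boundedAboveComplexes_map F)).localizedFunctor
    (S.acyclicCone (boundedAboveComplexes E)).Q (S'.acyclicCone (boundedAboveComplexes E')).Q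

end ExactStructure

/-!
The theorem is deduced from the notion of a projective embedding: a fully faithful exact functor
`F : E ⥤ B` to an abelian category that sends the objects of `P` to enough projectives
(`ExactStructure.IsProjectiveEmbedding`).

*Projective embeddings are derived equivalences.* Bounded above complexes in `B` have resolutions
by complexes with terms in `F(P)` (`CochainComplex.exists_resolution`), and such complexes of
projectives are colocal for the quasi-isomorphisms, so that the localization does not change the
morphisms out of them. Since `F` is fully faithful, both derived categories are therefore
equivalent to the homotopy category of complexes with terms in `P`. On the side of `E`, this needs
that `F` reflects acyclicity of bounded above complexes. If `F(g)` is an epimorphism, a deflation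
from an object of `P` factors through `g`, and in a weakly idempotent split category `g` is then
itself a deflation; this allows the construction of the cycles of the complex by descending
induction. If `P` is idempotent split, all projectives of `B` are in `F(P)`; if moreover the
global dimension is finite, bounded complexes have bounded resolutions, so that the bounded
derived categories are equivalent, too.

*The envelope is a projective embedding.* As `P` has weak kernels, the coherent functors on `P` form
an abelian category `M`, and the restricted Yoneda functor `R : E ⥤ M` is a projective embedding. A
right exact functor `T` on `E` extends to a right exact functor on `M`, which sends the cokernel of
`R(f)`, for `f` in `P`, to the cokernel of `T(f)`. In particular, `iR` extends to `H : M ⥤ A`. The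
universal property of `iR` provides a right exact functor `G : A ⥤ M` that extends `R`, and it
shows that `G ⋙ H` is the identity, because its restriction to `E` is `iR`. Then `G` is faithful, so
`iR` is fully faithful like `R`, and projectivity and generation carry over from `M` to `A` as `G`
and `H` preserve epimorphisms
(`ExactStructure.IsRightAbelianEnvelope.isProjectiveEmbedding`). The exactness of `iR` is automatic
(`ExactStructure.IsProjectivelyGenerating.isProjectiveEmbedding`).

The universal property is only available for abelian categories in certain universes. Both `M` and a
copy of `A` have models there (`CategoryTheory.Abelian.exists_equivalence`).
-/

/-! ### Localization at a class of morphisms with enough colocal objects -/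

namespace CategoryTheory

/-- Morphisms out of a `W`-colocal object are not affected by the localization at `W`: the functor
`Hom(X, -)` inverts `W`, hence descends to the localization, where it is represented by the image
of `X`. No calculus of fractions is needed. -/
lemma MorphismProperty.isColocal.map_bijective {T : Type u} [Category.{v} T]
    {W : MorphismProperty T} {X : T} (hX : W.isColocal X) (Y : T) :
    Function.Bijective (W.Q.map : (X ⟶ Y) → (W.Q.obj X ⟶ W.Q.obj Y)) := by
  let H : T ⥤ Type (max u v) := coyoneda.obj (Opposite.op X) ⋙ uliftFunctor.{u}
  have hW : W.IsInvertedBy H := fun Y Z f hf => by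
    have : IsIso ((coyoneda.obj (Opposite.op X)).map f) := by
      rw [isIso_iff_bijective]
      exact hX f hf
    dsimp only [H, Functor.comp_map]
    infer_instance
  -- the functor `Hom(X, -)` descends to the localization
  let F := Localization.lift H hW W.Q
  let e : W.Q ⋙ F ≅ H := Localization.fac H hW W.Q
  let y₀ : H.obj X := ULift.up (𝟙 X)
  let x₀ : F.obj (W.Q.obj X) := e.inv.app X y₀
  have hx₀ : (e.hom.app X x₀).down = 𝟙 X :=
    congrArg ULift.down
      (ConcreteCategory.congr_hom (e.inv_hom_id_app X) y₀)
  have key : ∀ {Z : T} (f : X ⟶ Z), (e.hom.app Z (F.map (W.Q.map f) x₀)).down = f :=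
    fun {Z} f => by
    have h := congrArg ULift.down (ConcreteCategory.congr_hom (e.hom.naturality f) x₀)
    refine h.trans ?_
    change (e.hom.app X x₀).down ≫ f = f
    rw [hx₀, Category.id_comp]
  -- a morphism out of `W.Q.obj X` is determined by the image of `x₀` under it
  let τ₀ : W.Q ⋙ F ⟶ W.Q ⋙ coyoneda.obj (Opposite.op (W.Q.obj X)) :=
    { app := fun Z => ↾fun f => W.Q.map (e.hom.app Z f).down
      naturality := fun Z Z' g => by
        ext f
        have h := congrArg ULift.down (ConcreteCategory.congr_hom (e.hom.naturality g) f)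
        exact (congrArg W.Q.map h).trans (W.Q.map_comp _ _) }
  let τ : F ⟶ coyoneda.obj (Opposite.op (W.Q.obj X)) :=
    Localization.liftNatTrans W.Q W _ _ _ _ τ₀
  have hτ : ∀ Z (f : F.obj (W.Q.obj Z)), τ.app (W.Q.obj Z) f = W.Q.map (e.hom.app Z f).down :=
    fun Z f => by
    have h : τ.app (W.Q.obj Z) = τ₀.app Z := by
      simp [τ, Localization.liftNatTrans_app]
    rw [h]
    rfl
  refine ⟨fun f g h => ?_, fun φ => ⟨(e.hom.app Y (F.map φ x₀)).down, ?_⟩⟩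
  · rw [← key f, ← key g, h]
  · rw [← hτ]
    have h := ConcreteCategory.congr_hom (τ.naturality φ) x₀
    refine h.trans ?_
    change τ.app _ x₀ ≫ φ = φ
    rw [hτ, hx₀]
    simp

lemma MorphismProperty.isEquivalence_comp_Q_of_isColocal {T L : Type*} [Category* T] [Category* L]
    (W : MorphismProperty T) (i : L ⥤ T) [i.Full] [i.Faithful]
    (h₁ : ∀ l, W.isColocal (i.obj l)) (h₂ : ∀ X, ∃ (l : L) (f : i.obj l ⟶ X), W f) :
    (i ⋙ W.Q).IsEquivalence where
  faithful := ⟨fun {_ _} _ _ h => i.map_injective (((h₁ _).map_bijective _).1 h)⟩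
  full := ⟨fun φ => by
    obtain ⟨f, hf⟩ := ((h₁ _).map_bijective _).2 φ
    exact ⟨i.preimage f, by simpa using hf⟩⟩
  essSurj := ⟨fun Y => by
    obtain ⟨X, ⟨e⟩⟩ : ∃ X, Nonempty (W.Q.obj X ≅ Y) :=
      ⟨_, ⟨(Localization.essSurj W.Q W).mem_essImage Y |>.choose_spec.some⟩⟩
    obtain ⟨l, f, hf⟩ := h₂ X
    exact ⟨l, ⟨Localization.isoOfHom W.Q W f hf ≪≫ e⟩⟩⟩

/-- A fully faithful morphism of localization data induces an equivalence of localizations if the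
source has a class `L` of objects whose images are colocal, and all objects of the source and of the
target can be resolved by `L`: both localizations are then equivalent to the full subcategory
`L`. -/
lemma LocalizerMorphism.isEquivalence_localizedFunctor_of_isColocal {T T' : Type*} [Category* T]
    [Category* T'] {W' : MorphismProperty T'} {W : MorphismProperty T}
    (Φ : LocalizerMorphism W' W) [Φ.functor.Full] [Φ.functor.Faithful] (L : ObjectProperty T')
    (hL : ∀ Q, L Q → W.isColocal (Φ.functor.obj Q))
    (h' : ∀ X, ∃ (Q : T') (f : Q ⟶ X), L Q ∧ W' f)
    (h : ∀ X, ∃ (Q : T') (f : Φ.functor.obj Q ⟶ X), L Q ∧ W f) :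
    (Φ.localizedFunctor W'.Q W.Q).IsEquivalence := by
  have hL' : ∀ Q, L Q → W'.isColocal Q := fun Q hQ Y Z g hg => by
    have hb := hL Q hQ _ (Φ.map g hg)
    refine ⟨fun a b hab => Φ.functor.map_injective (hb.1 ?_), fun a => ?_⟩
    · simpa using congrArg Φ.functor.map hab
    · obtain ⟨b, hb⟩ := hb.2 (Φ.functor.map a)
      exact ⟨Φ.functor.preimage b, Φ.functor.map_injective (by simpa using hb)⟩
  have h₁ : (L.ι ⋙ W'.Q).IsEquivalence :=
    W'.isEquivalence_comp_Q_of_isColocal L.ι (fun Q => hL' _ Q.property) fun X => by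
      obtain ⟨Q, f, hQ, hf⟩ := h' X
      exact ⟨⟨Q, hQ⟩, f, hf⟩
  have h₂ : ((L.ι ⋙ Φ.functor) ⋙ W.Q).IsEquivalence :=
    W.isEquivalence_comp_Q_of_isColocal (L.ι ⋙ Φ.functor) (fun Q => hL _ Q.property) fun X => by
      obtain ⟨Q, f, hQ, hf⟩ := h X
      exact ⟨⟨Q, hQ⟩, f, hf⟩
  have h₃ : ((L.ι ⋙ W'.Q) ⋙ Φ.localizedFunctor W'.Q W.Q).IsEquivalence :=
    Functor.isEquivalence_of_iso (F := (L.ι ⋙ Φ.functor) ⋙ W.Q)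
      (Functor.isoWhiskerLeft L.ι (CatCommSq.iso Φ.functor W'.Q W.Q (Φ.localizedFunctor W'.Q W.Q)))
  exact Functor.isEquivalence_of_comp_left (L.ι ⋙ W'.Q) _

end CategoryTheory

/-! ### Resolutions of bounded above complexes in an abelian category -/

section

variable {A : Type u} [Category.{v} A] [Abelian A]

lemma ExactStructure.IsAcyclic.acyclic {K : CochainComplex A ℤ}
    (hK : (ExactStructure.ofAbelian A).IsAcyclic K) : K.Acyclic := by
  obtain ⟨Z, i, p, h, hc, hd⟩ := hK
  intro n
  obtain ⟨m, rfl⟩ : ∃ m, m + 1 = n := ⟨n - 1, by lia⟩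
  rw [K.exactAt_iff' m (m + 1) (m + 1 + 1) (by simp) (by simp)]
  have : Epi (p m) := (hc m).epi_g
  have : Mono (i (m + 1 + 1)) := (hc (m + 1 + 1)).mono_f
  -- the complex `K` near degree `m + 1` is compared with the conflation in this degree
  let T := ShortComplex.mk (i (m + 1)) (K.d (m + 1) (m + 1 + 1))
    (by rw [hd, reassoc_of% (h (m + 1)), zero_comp])
  let φ : K.sc' m (m + 1) (m + 1 + 1) ⟶ T :=
    { τ₁ := p m
      τ₂ := 𝟙 (K.X (m + 1))
      τ₃ := 𝟙 (K.X (m + 1 + 1))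
      comm₁₂ := (hd m).symm.trans (Category.comp_id _).symm
      comm₂₃ := (Category.id_comp _).trans (Category.comp_id _).symm }
  let ψ : ShortComplex.mk (i (m + 1)) (p (m + 1)) (h (m + 1)) ⟶ T :=
    { τ₁ := 𝟙 (Z (m + 1))
      τ₂ := 𝟙 (K.X (m + 1))
      τ₃ := i (m + 1 + 1)
      comm₂₃ := (Category.id_comp _).trans (hd (m + 1)) }
  have : Epi φ.τ₁ := inferInstanceAs (Epi (p m))
  have : IsIso φ.τ₂ := inferInstanceAs (IsIso (𝟙 _))
  have : Mono φ.τ₃ := inferInstanceAs (Mono (𝟙 _))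
  have : Epi ψ.τ₁ := inferInstanceAs (Epi (𝟙 _))
  have : IsIso ψ.τ₂ := inferInstanceAs (IsIso (𝟙 _))
  have : Mono ψ.τ₃ := inferInstanceAs (Mono (i (m + 1 + 1)))
  rw [ShortComplex.exact_iff_of_epi_of_isIso_of_mono φ,
    ← ShortComplex.exact_iff_of_epi_of_isIso_of_mono ψ]
  exact (hc (m + 1)).exact

/-- The data from which the next term of a resolution of `X` is constructed: an object `Z` with
morphisms from all the terms of `X` which vanish on boundaries. (Only one of these morphisms
is relevant at each stage, the other ones are zero.) -/
structure ResolutionStage (X : CochainComplex A ℤ) where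
  /-- the object of relative cycles -/
  Z : A
  /-- the morphisms from the terms of `X` -/
  ξ (m : ℤ) : X.X m ⟶ Z
  w (l m : ℤ) : X.d l m ≫ ξ m = 0

namespace ResolutionStage

variable {X : CochainComplex A ℤ} {Q : A → A} (π : ∀ Z, Q Z ⟶ Z)

/-- The zero stage. -/
noncomputable def zero (X : CochainComplex A ℤ) : ResolutionStage X where
  Z := 0
  ξ _ := 0
  w _ _ := by simp

/-- If `Q ⟶ Z` is the chosen cover of the object of relative cycles in degree `m + 1`, the object
of relative cycles in degree `m` is the pullback of `Q` and `X m` over `Z`. -/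
noncomputable def next (s : ResolutionStage X) (m : ℤ) : ResolutionStage X where
  Z := pullback (π s.Z) (s.ξ m)
  ξ l := pullback.lift 0 (X.d l m) (by simp [s.w])
  w k l := by
    apply pullback.hom_ext
    · rw [Category.assoc, pullback.lift_fst]
      simp
    · rw [Category.assoc, pullback.lift_snd]
      simp

/-- The stages of the resolution, starting from the zero stage in degree `b`. -/
noncomputable def stage (X : CochainComplex A ℤ) (b : ℤ) : ℕ → ResolutionStage X
  | 0 => zero X
  | k + 1 => (stage X b k).next π (b - k - 1)

end ResolutionStage

/-- The recursion for a resolution of `X`, assembled into families indexed by all integers: `Z n` is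
the pullback of `Q (Z (n + 1))` and `X n` over `Z (n + 1)`, and vanishes for `n ≥ b`. -/
lemma CochainComplex.exists_relativeCycles {Q : A → A} (π : ∀ Z, Q Z ⟶ Z)
    (X : CochainComplex A ℤ) (b : ℤ) (hX : ∀ n, b ≤ n → IsZero (X.X n))
    (hQ : ∀ Z, IsZero Z → IsZero (Q Z)) :
    ∃ (Z : ℤ → A) (ξ : ∀ m n, X.X m ⟶ Z n)
      (a : ∀ m n : ℤ, m + 1 = n → (Z m ⟶ Q (Z n))) (c : ∀ m, Z m ⟶ X.X m),
      (∀ n, b ≤ n → IsZero (Z n)) ∧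
      (∀ m n (h : m + 1 = n), IsPullback (a m n h) (c m) (π (Z n)) (ξ m n)) ∧
      (∀ l m n (h : m + 1 = n), ξ l m ≫ a m n h = 0) ∧
      (∀ l m, ξ l m ≫ c m = X.d l m) := by
  let S : ℤ → ResolutionStage X := fun n => ResolutionStage.stage π X b (b - n).toNat
  have hS₀ : ∀ n, b ≤ n → S n = ResolutionStage.zero X := fun n hn => by
    simp only [S]
    rw [show (b - n).toNat = 0 by lia]
    rfl
  have hZ₀ : ∀ n, b ≤ n → IsZero (S n).Z := fun n hn => by
    rw [hS₀ n hn]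
    exact isZero_zero A
  have hS : ∀ m n, m + 1 = n → n ≤ b → S m = (S n).next π m := fun m n h hn => by
    simp only [S]
    rw [show (b - m).toNat = (b - n).toNat + 1 by lia, ResolutionStage.stage]
    congr 1
    lia
  have key : ∀ m n, m + 1 = n → ∃ (a : (S m).Z ⟶ Q (S n).Z) (c : (S m).Z ⟶ X.X m),
      IsPullback a c (π (S n).Z) ((S n).ξ m) ∧ (∀ l, (S m).ξ l ≫ a = 0) ∧
        (∀ l, (S m).ξ l ≫ c = X.d l m) := by
    intro m n h
    by_cases hn : n ≤ b
    · rw [hS m n h hn]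
      exact ⟨pullback.fst _ _, pullback.snd _ _, IsPullback.of_hasPullback _ _,
        fun l => pullback.lift_fst _ _ _, fun l => pullback.lift_snd _ _ _⟩
    · have hm := hX m (by lia)
      refine ⟨0, 0, ?_, fun l => by simp, fun l => hm.eq_of_tgt _ _⟩
      have h₁ := hZ₀ n (by lia)
      have h₂ := hQ _ h₁
      have h₃ : IsIso (0 : (S m).Z ⟶ X.X m) := (hZ₀ m (by lia)).isIso hm _
      have h₄ : IsIso (π (S n).Z) := h₂.isIso h₁ _
      exact IsPullback.of_vert_isIso ⟨h₁.eq_of_tgt _ _⟩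
  choose a c h₁ h₂ h₃ using key
  exact ⟨fun n => (S n).Z, fun m n => (S n).ξ m, a, fun m => c m (m + 1) rfl, hZ₀,
    fun m n h => by subst h; exact h₁ m _ rfl, fun l m n h => h₂ m n h l,
    fun l m => h₃ m _ rfl l⟩

/-- If a morphism of complexes `f : L ⟶ X` factors in each degree through objects `Z n` which are
the pullbacks of `L (n + 1)` and `X n` over `Z (n + 1)`, then `Z n` is the object of
cycles of the mapping cone of `f`, and the mapping cone is acyclic. -/
lemma CochainComplex.isAcyclic_mappingCone_of_isPullback {L X : CochainComplex A ℤ} (f : L ⟶ X)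
    (Z : ℤ → A) (q : ∀ n, L.X n ⟶ Z n) [∀ n, Epi (q n)] (ξ : ∀ n, X.X n ⟶ Z (n + 1))
    (a : ∀ n, Z n ⟶ L.X (n + 1)) (c : ∀ n, Z n ⟶ X.X n)
    (hac : ∀ n, IsPullback (a n) (c n) (q (n + 1)) (ξ n))
    (hξa : ∀ n, ξ n ≫ a (n + 1) = 0) (hξc : ∀ n, ξ n ≫ c (n + 1) = X.d n (n + 1))
    (hLd : ∀ n, L.d n (n + 1) = q n ≫ a n) (hf : ∀ n, f.f n = q n ≫ c n) :
    (ExactStructure.ofAbelian A).IsAcyclic (CochainComplex.mappingCone f) := by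
  let i : ∀ n, Z n ⟶ (CochainComplex.mappingCone f).X n := fun n =>
    -a n ≫ (CochainComplex.mappingCone.inl f).v (n + 1) n (by lia) +
      c n ≫ (CochainComplex.mappingCone.inr f).f n
  let p : ∀ n, (CochainComplex.mappingCone f).X n ⟶ Z (n + 1) := fun n =>
    (CochainComplex.mappingCone.fst f).1.v n (n + 1) rfl ≫ q (n + 1) +
      (CochainComplex.mappingCone.snd f).v n n (add_zero n) ≫ ξ n
  have hinl : ∀ n, (CochainComplex.mappingCone.inl f).v (n + 1) n (by lia) ≫ p n =
      q (n + 1) := fun n => by simp [p]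
  have hinr : ∀ n, (CochainComplex.mappingCone.inr f).f n ≫ p n = ξ n := fun n => by
    simp [p]
  have w : ∀ n, i n ≫ p n = 0 := fun n => by
    dsimp only [i]
    rw [Preadditive.add_comp, Preadditive.neg_comp, Category.assoc, Category.assoc, hinl, hinr,
      (hac n).w, neg_add_cancel]
  refine ⟨Z, i, p, w, fun n => ?_, fun n => ?_⟩
  · have hlim : IsLimit (KernelFork.ofι (i n) (w n)) := by
      have hm : Mono (i n) := ⟨fun g h hgh => by
        have h₁ := congrArg (· ≫ (CochainComplex.mappingCone.fst f).1.v n (n + 1) rfl) hgh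
        have h₂ := congrArg (· ≫ (CochainComplex.mappingCone.snd f).v n n (add_zero n)) hgh
        refine (hac n).hom_ext ?_ ?_
        · simpa [i] using h₁
        · simpa [i] using h₂⟩
      refine KernelFork.IsLimit.ofι' _ _ fun {T} k hk => ?_
      have h₀ : (-(k ≫ (CochainComplex.mappingCone.fst f).1.v n (n + 1) rfl)) ≫ q (n + 1) =
          (k ≫ (CochainComplex.mappingCone.snd f).v n n (add_zero n)) ≫ ξ n := by
        rw [Preadditive.neg_comp, neg_eq_iff_add_eq_zero]
        simpa [p] using hk
      refine ⟨(hac n).lift _ _ h₀, ?_⟩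
      apply CochainComplex.mappingCone.ext_to f n (n + 1) rfl
      · simp [i]
      · simp [i]
    exact
      { exact := ShortComplex.exact_of_f_is_kernel _ hlim
        mono_f := Fork.IsLimit.mono hlim
        epi_g := by
          have : Epi ((CochainComplex.mappingCone.inl f).v (n + 1) n (by lia) ≫ p n) := by
            rw [hinl]
            infer_instance
          exact epi_of_epi ((CochainComplex.mappingCone.inl f).v (n + 1) n _) (p n) }
  · apply CochainComplex.mappingCone.ext_from f (n + 1) n rfl
    · rw [CochainComplex.mappingCone.inl_v_d f (n + 1) n (n + 1 + 1) (by lia) (by lia),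
        reassoc_of% hinl, hLd, hf]
      simp [i]
      abel
    · rw [CochainComplex.mappingCone.inr_f_d, reassoc_of% hinr]
      simp [i, reassoc_of% hξa, reassoc_of% hξc]

/-- Given a choice of epimorphisms `π Z : Q Z ⟶ Z`, every bounded above complex `X` is
quasi-isomorphic to a bounded above complex `L` whose terms are of the form `Q Z`. In the degrees
where `X` vanishes, the objects `Z` are obtained by taking successive syzygies. -/
lemma CochainComplex.exists_resolution_of_covers {Q : A → A} (π : ∀ Z, Q Z ⟶ Z)
    [∀ Z, Epi (π Z)] (hQ : ∀ Z, IsZero Z → IsZero (Q Z)) (X : CochainComplex A ℤ) (b : ℤ)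
    (hX : ∀ n, b ≤ n → IsZero (X.X n)) :
    ∃ (Z : ℤ → A) (L : CochainComplex A ℤ) (f : L ⟶ X), (∀ n, L.X n = Q (Z n)) ∧
      (∀ n, b ≤ n → IsZero (Z n)) ∧
      (∀ m, IsZero (X.X m) → ∃ (i : Z m ⟶ Q (Z (m + 1))) (w : i ≫ π (Z (m + 1)) = 0),
        (ShortComplex.mk i (π (Z (m + 1))) w).ShortExact) ∧
      (ExactStructure.ofAbelian A).IsAcyclic (CochainComplex.mappingCone f) := by
  obtain ⟨Z, ξ, a, c, hZ, hac, hξa, hξc⟩ := exists_relativeCycles π X b hX hQ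
  let L : CochainComplex A ℤ := CochainComplex.of (fun n => Q (Z n))
    (fun n => π (Z n) ≫ a n (n + 1) rfl) (fun n => by
      rw [Category.assoc, reassoc_of% (hac n (n + 1) rfl).w, hξa]
      simp)
  have hLd : ∀ n, L.d n (n + 1) = π (Z n) ≫ a n (n + 1) rfl := fun n => by simp [L]
  let f : L ⟶ X :=
    { f := fun n => π (Z n) ≫ c n
      comm' := fun n m h => by
        obtain rfl : n + 1 = m := h
        rw [hLd, Category.assoc, Category.assoc, reassoc_of% (hac n (n + 1) rfl).w, hξc] }
  refine ⟨Z, L, f, fun n => rfl, hZ, fun m hm => ?_, ?_⟩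
  · have w : a m (m + 1) rfl ≫ π (Z (m + 1)) = 0 := by
      rw [(hac m (m + 1) rfl).w, hm.eq_of_tgt (c m) 0, zero_comp]
    refine ⟨a m (m + 1) rfl, w, ?_⟩
    have : Mono (a m (m + 1) rfl) := ⟨fun g h hgh =>
      (hac m (m + 1) rfl).hom_ext hgh (hm.eq_of_tgt _ _)⟩
    have hlim : IsLimit (KernelFork.ofι (a m (m + 1) rfl) w) :=
      KernelFork.IsLimit.ofι' _ _ fun {T} k hk => ⟨(hac m (m + 1) rfl).lift k 0 (by simp [hk]),
        (hac m (m + 1) rfl).lift_fst _ _ _⟩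
    exact
      { exact := ShortComplex.exact_of_f_is_kernel _ hlim
        mono_f := Fork.IsLimit.mono hlim
        epi_g := ‹∀ Z, Epi (π Z)› _ }
  · exact isAcyclic_mappingCone_of_isPullback f Z (fun n => π (Z n)) (fun n => ξ n (n + 1))
      (fun n => a n (n + 1) rfl) c (fun n => hac n (n + 1) rfl) (fun n => hξa _ _ _ _)
      (fun n => hξc _ _) hLd (fun n => rfl)

/-- Resolutions of bounded above complexes by objects of a class `𝒬` of projectives which covers
all objects. An object of `𝒬` is covered by itself; hence, if `𝒬` contains all the projectives and
the global dimension is finite, the resolution of a bounded complex stops as soon as the syzygies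
are projective, and is bounded. -/
lemma CochainComplex.exists_resolution (𝒬 : ObjectProperty A) [𝒬.IsClosedUnderIsomorphisms]
    (h₀ : 𝒬 (0 : A)) (hproj : ∀ Z, 𝒬 Z → Projective Z)
    (hcov : ∀ Z : A, ∃ (Q : A) (π : Q ⟶ Z), 𝒬 Q ∧ Epi π) (X : CochainComplex A ℤ) (b : ℤ)
    (hX : ∀ n, b ≤ n → IsZero (X.X n)) :
    ∃ (L : CochainComplex A ℤ) (f : L ⟶ X), (∀ n, 𝒬 (L.X n)) ∧ (∀ n, b ≤ n → IsZero (L.X n)) ∧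
      (ExactStructure.ofAbelian A).IsAcyclic (CochainComplex.mappingCone f) ∧
      ((∀ Z, Projective Z → 𝒬 Z) → HasFiniteGlobalDimension A →
        (∃ a, ∀ n, n < a → IsZero (X.X n)) → ∃ a, ∀ n, n < a → IsZero (L.X n)) := by
  have hcov' : ∀ Z : A, ∃ (Q : A) (π : Q ⟶ Z), 𝒬 Q ∧ Epi π ∧ (𝒬 Z → IsIso π) := fun Z => by
    by_cases hZ : 𝒬 Z
    · exact ⟨Z, 𝟙 Z, hZ, inferInstance, fun _ => inferInstance⟩
    · obtain ⟨Q, π, h₁, h₂⟩ := hcov Z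
      exact ⟨Q, π, h₁, h₂, fun h => (hZ h).elim⟩
  choose Q π hQ hπ hiso using hcov'
  have hzero : ∀ Z, IsZero Z → 𝒬 Z := fun Z hZ => 𝒬.prop_of_iso ((isZero_zero A).iso hZ) h₀
  have hQzero : ∀ Z, IsZero Z → IsZero (Q Z) := fun Z hZ => by
    have := hiso Z (hzero Z hZ)
    exact hZ.of_iso (asIso (π Z))
  obtain ⟨Z, L, f, hL, hZ, hsyz, hcone⟩ := exists_resolution_of_covers π hQzero X b hX
  refine ⟨L, f, fun n => by rw [hL]; exact hQ _, fun n hn => ?_, hcone, ?_⟩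
  · rw [hL]
    exact hQzero _ (hZ n hn)
  rintro hproj' ⟨N, hN⟩ ⟨a, ha⟩
  -- one syzygy lowers the projective dimension by one
  have hdim : ∀ (j : ℕ) (n : ℤ), n ≤ a - j → HasProjectiveDimensionLT (Z n) (N - j + 1) := by
    intro j
    induction j with
    | zero =>
      intro n _
      have := hN (Z n)
      exact hasProjectiveDimensionLT_of_ge _ N _ (by lia)
    | succ j hj =>
      intro n hn
      obtain ⟨i, w, hS⟩ := hsyz n (ha n (by lia))
      have h₃ := hj (n + 1) (by lia)
      have h₂ : Projective (Q (Z (n + 1))) := hproj _ (hQ _)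
      have h₂' : HasProjectiveDimensionLT (Q (Z (n + 1))) (N - (j + 1) + 1) :=
        hasProjectiveDimensionLT_of_ge _ 1 _ (by lia)
      have : HasProjectiveDimensionLT (Z (n + 1)) (N - (j + 1) + 1 + 1) :=
        hasProjectiveDimensionLT_of_ge _ (N - j + 1) _ (by lia)
      exact hS.hasProjectiveDimensionLT_X₁ _ h₂' this
  refine ⟨a - N - 1, fun n hn => ?_⟩
  rw [hL]
  apply hQzero
  obtain ⟨i, w, hS⟩ := hsyz n (ha n (by lia))
  have hpd := hdim N (n + 1) (by lia)
  rw [Nat.sub_self, zero_add, ← projective_iff_hasProjectiveDimensionLT_one] at hpd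
  have := hiso _ (hproj' _ hpd)
  have := hS.mono_f
  refine IsZero.of_mono_eq_zero i ?_
  rw [← cancel_mono (π (Z (n + 1))), w, zero_comp]

end

/-! ### Deflations and acyclic complexes in a weakly idempotent split exact category -/

section

variable {E : Type u} [Category.{v} E] [Preadditive E] [HasZeroObject E] [HasBinaryBiproducts E]
  {B : Type u'} [Category.{v'} B] [Abelian B]

namespace ExactStructure

variable {S : ExactStructure E}

/-- A deflation together with any of its kernels is a conflation. -/
lemma IsDeflation.conflation_of_isLimit {X Y Z : E} {d : Y ⟶ Z} (hd : S.IsDeflation d)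
    {i : X ⟶ Y} (w : i ≫ d = 0) (hi : IsLimit (KernelFork.ofι i w)) :
    S.conflation (ShortComplex.mk i d w) := by
  obtain ⟨X', i', w', hc⟩ := hd
  obtain ⟨hi'⟩ := S.isKernel hc
  let e : X' ≅ X := hi'.conePointUniqueUpToIso hi
  have he : e.hom ≫ i = i' := hi'.conePointUniqueUpToIso_hom_comp hi WalkingParallelPair.zero
  exact S.of_iso (S := ShortComplex.mk i' d w') (T := ShortComplex.mk i d w)
    (ShortComplex.isoMk e (Iso.refl _) (Iso.refl _) (by simp [he]) (by simp)) hc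

lemma IsDeflation.epi {Y Z : E} {d : Y ⟶ Z} (hd : S.IsDeflation d) : Epi d := by
  obtain ⟨_, _, _, hc⟩ := hd
  exact Cofork.IsColimit.epi (S.isCokernel hc).some

/-- Quillen's "obscure axiom" for deflations: if a composite `f ≫ g` is a deflation, so is `g`. The
existence of a kernel of `g` need not be assumed: it is the kernel of the retraction of
the pullback of `f ≫ g` and `g` onto the source of `f`. -/
lemma IsDeflation.of_comp (hE : IsWeaklyIdempotentSplit E) {X Y Z : E} (f : X ⟶ Y) (g : Y ⟶ Z)
    (h : S.IsDeflation (f ≫ g)) : S.IsDeflation g := by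
  have hfg := h.epi
  obtain ⟨N, n, hn, hN⟩ := h
  obtain ⟨hnl⟩ := S.isKernel hN
  obtain ⟨hnc⟩ := S.isCokernel hN
  obtain ⟨Y', f', d', sq, hd'⟩ := S.pullback_deflation (f ≫ g) g ⟨N, n, hn, hN⟩
  have hd'e : Epi d' := IsDeflation.epi (S := S) hd'
  obtain ⟨M, m, hm, hM⟩ := hd'
  obtain ⟨hmc⟩ := S.isCokernel hM
  -- the pullback of `X` and `Y` over `Z` decomposes as the direct sum of `X` and the kernel of `g`
  let s : X ⟶ Y' := sq.lift (𝟙 X) f (by simp)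
  have hsf : s ≫ f' = 𝟙 X := sq.lift_fst _ _ _
  have hsd : s ≫ d' = f := sq.lift_snd _ _ _
  have := hE f' s hsf
  let κ := kernel.ι f'
  have hκ : κ ≫ f' = 0 := kernel.condition f'
  let k : kernel f' ⟶ Y := κ ≫ d'
  have hk : k ≫ g = 0 := by rw [Category.assoc, ← sq.w, reassoc_of% hκ, zero_comp]
  have hkl : IsLimit (KernelFork.ofι k hk) := by
    have : Mono k := ⟨fun a b hab => by
      rw [← cancel_mono κ]
      refine sq.hom_ext ?_ ?_
      · simp only [Category.assoc, hκ, comp_zero]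
      · simpa [k] using hab⟩
    refine KernelFork.IsLimit.ofι' _ _ fun {T} l hl =>
      ⟨kernel.lift f' (sq.lift 0 l (by simp [hl])) (sq.lift_fst _ _ _), ?_⟩
    rw [kernel.lift_ι_assoc]
    exact sq.lift_snd _ _ _
  have hkm : Mono k := Fork.IsLimit.mono hkl
  obtain ⟨j, hj⟩ := KernelFork.IsLimit.lift' hkl (n ≫ f) (by rw [Category.assoc, hn])
  replace hj : j ≫ k = n ≫ f := hj
  let r : Y' ⟶ kernel f' := kernel.lift f' (𝟙 Y' - f' ≫ s) (by simp [hsf])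
  have hr : r ≫ κ = 𝟙 Y' - f' ≫ s := kernel.lift_ι _ _ _
  have hsr : s ≫ r = 0 := by
    rw [← cancel_mono κ, Category.assoc, hr]
    simp [reassoc_of% hsf]
  have hκr : κ ≫ r = 𝟙 _ := by
    rw [← cancel_mono κ, Category.assoc, hr]
    simp [reassoc_of% hκ]
  have hrk : r ≫ k = d' - f' ≫ f := by
    rw [← Category.assoc, hr, Preadditive.sub_comp, Category.id_comp, Category.assoc, hsd]
  -- `Y` is the pushout of `X` and the kernel of `g` under the kernel of `f ≫ g`
  obtain ⟨Y'', f'', i', po, hi'⟩ := S.pushout_inflation n j ⟨_, _, _, hN⟩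
  let u : Y'' ⟶ Y := po.desc f k hj.symm
  have hfu : f'' ≫ u = f := po.inl_desc _ _ _
  have hiu : i' ≫ u = k := po.inr_desc _ _ _
  obtain ⟨t, ht⟩ := KernelFork.IsLimit.lift' hnl (m ≫ f')
    (by rw [Category.assoc, sq.w, reassoc_of% hm, zero_comp])
  replace ht : t ≫ n = m ≫ f' := ht
  have hmr : m ≫ r = -(t ≫ j) := by
    rw [← cancel_mono k, Category.assoc, hrk, Preadditive.neg_comp, Category.assoc, hj,
      Preadditive.comp_sub, hm, reassoc_of% ht, zero_sub]
  obtain ⟨v, hv⟩ := CokernelCofork.IsColimit.desc' hmc (f' ≫ f'' + r ≫ i') (by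
    change m ≫ _ = 0
    rw [Preadditive.comp_add, ← reassoc_of% ht, reassoc_of% hmr, po.w]
    simp)
  replace hv : d' ≫ v = f' ≫ f'' + r ≫ i' := hv
  have huv : u ≫ v = 𝟙 _ := by
    apply po.hom_ext
    · rw [reassoc_of% hfu, ← hsd, Category.assoc, hv]
      simp [reassoc_of% hsf, reassoc_of% hsr]
    · rw [reassoc_of% hiu, Category.assoc, hv]
      simp [reassoc_of% hκ, reassoc_of% hκr]
  have hvu : v ≫ u = 𝟙 _ := by
    rw [← cancel_epi d', reassoc_of% hv]
    simp [hfu, hiu, hrk]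
  obtain ⟨Q, q, hq, hQ⟩ := hi'
  obtain ⟨hqc⟩ := S.isCokernel hQ
  have hug : i' ≫ u ≫ g = 0 := by rw [reassoc_of% hiu, hk]
  have huge : Epi (u ≫ g) := by
    have : Epi (f'' ≫ u ≫ g) := by rwa [reassoc_of% hfu]
    exact epi_of_epi f'' _
  have hgc : IsColimit (CokernelCofork.ofπ (u ≫ g) hug) :=
    CokernelCofork.IsColimit.ofπ' _ _ fun {T} l hl => by
      obtain ⟨e, he⟩ := CokernelCofork.IsColimit.desc' hnc (f'' ≫ l) (by
        change n ≫ _ = 0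
        rw [po.w_assoc, hl, comp_zero])
      refine ⟨e, ?_⟩
      replace he : (f ≫ g) ≫ e = f'' ≫ l := he
      apply po.hom_ext
      · rw [← he, Category.assoc, reassoc_of% hfu, Category.assoc]
      · rw [hl, Category.assoc, reassoc_of% hiu, reassoc_of% hk, zero_comp]
  let e : Q ≅ Z := hqc.coconePointUniqueUpToIso hgc
  have he : q ≫ e.hom = u ≫ g := hqc.comp_coconePointUniqueUpToIso_hom hgc WalkingParallelPair.one
  let e' : Y'' ≅ Y := ⟨u, v, huv, hvu⟩
  refine ⟨_, k, hk, S.of_iso (S := ShortComplex.mk i' q hq) (T := ShortComplex.mk k g hk)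
    (ShortComplex.isoMk (Iso.refl _) e' e ?_ ?_) hQ⟩
  · exact (Category.id_comp _).trans hiu.symm
  · exact he.symm

end ExactStructure

/-- A functor `F` from an exact category `E` to an abelian category identifies `E` with an exact
subcategory in which the objects of `P` become enough projectives: `F` is exact and fully faithful,
it sends the objects of `P` to projective objects, and every object of the target is a quotient of
such a projective object. -/
structure ExactStructure.IsProjectiveEmbedding (S : ExactStructure E) (P : ObjectProperty E)
    (F : E ⥤ B) : Prop where
  exact : S.IsExactFunctor (ofAbelian B) F
  full : F.Full
  faithful : F.Faithful
  projective : ∀ X, P X → Projective (F.obj X)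
  exists_epi : ∀ b : B, ∃ (X : E) (π : F.obj X ⟶ b), P X ∧ Epi π

namespace ExactStructure

variable {S : ExactStructure E} {P : ObjectProperty E} {F : E ⥤ B}

omit [Abelian B] in
/-- A fully faithful functor that sends the objects of `P` to projectives reflects deflations: if
`F.map g` is an epimorphism, a deflation from an object of `P` factors through `g`. -/
lemma isDeflation_of_epi (hE : IsWeaklyIdempotentSplit E) (hP : S.IsProjectivelyGenerating P)
    (hfull : F.Full) (hfaith : F.Faithful) (hproj : ∀ X, P X → Projective (F.obj X))
    {Y Z : E} (g : Y ⟶ Z) (hg : Epi (F.map g)) : S.IsDeflation g := by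
  obtain ⟨Q, d, hQ, hd⟩ := hP.exists_deflation Z
  have := hproj Q hQ
  obtain ⟨t, ht⟩ := F.map_surjective (Projective.factorThru (F.map d) (F.map g))
  have : t ≫ g = d := F.map_injective (by rw [F.map_comp, ht, Projective.factorThru_comp])
  exact .of_comp hE t g (by rwa [this])

namespace IsProjectiveEmbedding

lemma isDeflation (hF : S.IsProjectiveEmbedding P F) (hE : IsWeaklyIdempotentSplit E)
    (hP : S.IsProjectivelyGenerating P) {Y Z : E} (g : Y ⟶ Z) (hg : Epi (F.map g)) :
    S.IsDeflation g :=
  isDeflation_of_epi hE hP hF.full hF.faithful hF.projective g hg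

/-- The object of cycles of a bounded above complex `K` with acyclic image, constructed by
descending induction from the degree `b` above which `K` vanishes: the differential
`K (n - 1) ⟶ K n` is the composite of a deflation and a kernel of the next differential. -/
lemma exists_kernel_of_acyclic [F.Additive] (hF : S.IsProjectiveEmbedding P F)
    (hE : IsWeaklyIdempotentSplit E) (hP : S.IsProjectivelyGenerating P)
    (K : CochainComplex E ℤ) (b : ℤ)
    (hb : ∀ n, b ≤ n → IsZero (K.X n))
    (hK : ∀ l m n : ℤ, l + 1 = m → m + 1 = n → ((K.sc' l m n).map F).Exact)
    (k : ℕ) (n : ℤ) (hn : b - k ≤ n) :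
    ∃ (Z : E) (i : Z ⟶ K.X n) (w : i ≫ K.d n (n + 1) = 0),
      Nonempty (IsLimit (KernelFork.ofι i w)) ∧
      ∀ m, m + 1 = n → ∃ p : K.X m ⟶ Z, p ≫ i = K.d m n ∧ S.IsDeflation p := by
  induction k generalizing n with
  | zero =>
    have hz := hb n (by simpa using hn)
    refine ⟨0, 0, by simp, ⟨?_⟩, fun m hm => ⟨0, hz.eq_of_tgt _ _, ?_⟩⟩
    · exact KernelFork.IsLimit.ofι _ _ (fun _ _ => 0) (fun _ _ => hz.eq_of_tgt _ _)
        (fun _ _ _ _ => (isZero_zero E).eq_of_tgt _ _)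
    · exact hF.isDeflation hE hP _ ⟨fun _ _ _ => (F.map_isZero (isZero_zero E)).eq_of_src _ _⟩
  | succ k hk =>
    obtain ⟨Z₁, i₁, w₁, ⟨hi₁⟩, h₁⟩ := hk (n + 1) (by push_cast at hn; lia)
    have hm₁ : Mono i₁ := Fork.IsLimit.mono hi₁
    obtain ⟨p, hp, Z, i, w, hc⟩ := h₁ n rfl
    obtain ⟨hi⟩ := S.isKernel hc
    have hiF : Mono (F.map i) := (hF.exact.map_conflation _ hc).mono_f
    have w' : i ≫ K.d n (n + 1) = 0 := by rw [← hp, reassoc_of% w, zero_comp]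
    refine ⟨Z, i, w', ⟨?_⟩, fun m hm => ?_⟩
    · have : Mono i := Fork.IsLimit.mono hi
      exact KernelFork.IsLimit.ofι' _ _ fun {T} l hl =>
        KernelFork.IsLimit.lift' hi l (by
          rw [← cancel_mono i₁]
          change (l ≫ p) ≫ i₁ = _
          rw [Category.assoc, hp, hl, zero_comp])
    · obtain ⟨p', hp'⟩ : ∃ p' : K.X m ⟶ Z, p' ≫ i = K.d m n := by
        obtain ⟨p', hp'⟩ := KernelFork.IsLimit.lift' hi (K.d m n) (by
          rw [← cancel_mono i₁]
          change (K.d m n ≫ p) ≫ i₁ = _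
          rw [Category.assoc, hp, K.d_comp_d, zero_comp])
        exact ⟨p', hp'⟩
      refine ⟨p', hp', hF.isDeflation hE hP _ ?_⟩
      have hex := hK m n (n + 1) hm rfl
      rw [ShortComplex.exact_iff_exact_up_to_refinements] at hex
      obtain ⟨T, π, hπ, x, hx⟩ : ∃ (T : B) (π : T ⟶ F.obj Z) (_ : Epi π) (x : T ⟶ F.obj (K.X m)),
          π ≫ F.map i = x ≫ F.map (K.d m n) := hex (F.map i) (by
        change F.map i ≫ F.map (K.d n (n + 1)) = 0
        rw [← F.map_comp, w', F.map_zero])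
      have hx' : x ≫ F.map p' = π := by
        rw [← cancel_mono (F.map i), Category.assoc, ← F.map_comp, hp', hx]
      have : Epi (x ≫ F.map p') := by rwa [hx']
      exact epi_of_epi x _

/-- A bounded above complex is acyclic in the exact category if its image in the abelian category
is. -/
lemma isAcyclic [F.Additive] (hF : S.IsProjectiveEmbedding P F) (hE : IsWeaklyIdempotentSplit E)
    (hP : S.IsProjectivelyGenerating P) (K : CochainComplex E ℤ) (b : ℤ)
    (hb : ∀ n, b ≤ n → IsZero (K.X n))
    (hK : ((F.mapHomologicalComplex (ComplexShape.up ℤ)).obj K).Acyclic) : S.IsAcyclic K := by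
  have hex : ∀ l m n : ℤ, l + 1 = m → m + 1 = n → ((K.sc' l m n).map F).Exact :=
    fun l m n h h' => by
      have := hK m
      rwa [HomologicalComplex.exactAt_iff' _ l m n (by simp; lia) (by simp [h'])] at this
  choose Z i w hi hp using fun n : ℤ =>
    hF.exists_kernel_of_acyclic hE hP K b hb hex (b - n).toNat n (by lia)
  choose p hp hd using fun n => hp (n + 1) n rfl
  have hm : ∀ n, Mono (i n) := fun n => Fork.IsLimit.mono (hi n).some
  have hip : ∀ n, i n ≫ p n = 0 := fun n => by
    rw [← cancel_mono (i (n + 1)), Category.assoc, hp, w, zero_comp]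
  refine ⟨Z, i, p, hip, fun n => (hd n).conflation_of_isLimit _ ?_, fun n => (hp n).symm⟩
  exact KernelFork.IsLimit.ofι' _ _ fun {T} l hl =>
    KernelFork.IsLimit.lift' (hi n).some l (by rw [← hp, reassoc_of% hl, zero_comp])

end IsProjectiveEmbedding

end ExactStructure

end

/-! ### Derived equivalences -/

section

variable {E : Type u} [Category.{v} E] [Preadditive E]
  {B : Type u'} [Category.{v'} B] [Preadditive B]

/-- A complex whose terms are in the image of a fully faithful functor lifts along this functor. -/
lemma CochainComplex.exists_iso_mapHomologicalComplex_obj (F : E ⥤ B) [F.Additive] [F.Full]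
    [F.Faithful] (P : ObjectProperty E) (L : CochainComplex B ℤ)
    (hL : ∀ n, ∃ X : E, P X ∧ Nonempty (F.obj X ≅ L.X n)) :
    ∃ K : CochainComplex E ℤ, (∀ n, P (K.X n)) ∧
      Nonempty ((F.mapHomologicalComplex (ComplexShape.up ℤ)).obj K ≅ L) := by
  choose X hX e using hL
  replace e := fun n => (e n).some
  let K : CochainComplex E ℤ :=
    { X := X
      d := fun i j => F.preimage ((e i).hom ≫ L.d i j ≫ (e j).inv)
      shape := fun i j hij => F.map_injective (by simp [L.shape i j hij])
      d_comp_d' := fun i j k _ _ => F.map_injective (by simp) }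
  let e' : ∀ n, ((F.mapHomologicalComplex (ComplexShape.up ℤ)).obj K).X n ≅ L.X n := e
  have hd : ∀ i j, ((F.mapHomologicalComplex (ComplexShape.up ℤ)).obj K).d i j =
    (e' i).hom ≫ L.d i j ≫ (e' j).inv := fun i j => F.map_preimage _
  exact ⟨K, hX, ⟨HomologicalComplex.Hom.isoOfComponents e' (fun i j _ => by rw [hd]; simp)⟩⟩

variable [HasBinaryBiproducts E]

lemma boundedAboveComplexes_mappingCone {K L : CochainComplex E ℤ} (f : K ⟶ L)
    (hK : boundedAboveComplexes E ((HomotopyCategory.quotient _ _).obj K))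
    (hL : boundedAboveComplexes E ((HomotopyCategory.quotient _ _).obj L)) :
    boundedAboveComplexes E
      ((HomotopyCategory.quotient _ _).obj (CochainComplex.mappingCone f)) := by
  obtain ⟨b, hb⟩ := hK
  obtain ⟨b', hb'⟩ := hL
  refine ⟨max b b', fun n hn => ?_⟩
  exact (CochainComplex.mappingCone.isZero_X_iff f n).2 ⟨hb _ (by lia), hb' _ (by lia)⟩

lemma boundedComplexes_mappingCone {K L : CochainComplex E ℤ} (f : K ⟶ L)
    (hK : boundedComplexes E ((HomotopyCategory.quotient _ _).obj K))
    (hL : boundedComplexes E ((HomotopyCategory.quotient _ _).obj L)) :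
    boundedComplexes E ((HomotopyCategory.quotient _ _).obj (CochainComplex.mappingCone f)) := by
  obtain ⟨a, b, hb⟩ := hK
  obtain ⟨a', b', hb'⟩ := hL
  refine ⟨min a a' - 1, max b b', fun n hn => ?_⟩
  exact (CochainComplex.mappingCone.isZero_X_iff f n).2 ⟨hb _ (by lia), hb' _ (by lia)⟩

end

section

variable {E : Type u} [Category.{v} E] [Preadditive E] [HasZeroObject E] [HasBinaryBiproducts E]
  {B : Type u'} [Category.{v'} B] [Abelian B]

namespace ExactStructure

lemma IsAcyclic.of_iso {S : ExactStructure E} {K L : CochainComplex E ℤ} (e : K ≅ L)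
    (hK : S.IsAcyclic K) : S.IsAcyclic L := by
  obtain ⟨Z, i, p, h, hc, hd⟩ := hK
  have he : ∀ n, e.hom.f n ≫ e.inv.f n = 𝟙 _ := fun n => by
    rw [← HomologicalComplex.comp_f, e.hom_inv_id, HomologicalComplex.id_f]
  refine ⟨Z, fun n => i n ≫ e.hom.f n, fun n => e.inv.f n ≫ p n, fun n => ?_, fun n => ?_,
    fun n => ?_⟩
  · rw [Category.assoc, reassoc_of% (he n), h]
  · refine S.of_iso (S := ShortComplex.mk (i n) (p n) (h n)) (T := ShortComplex.mk
      (i n ≫ e.hom.f n) (e.inv.f n ≫ p n) (by rw [Category.assoc, reassoc_of% (he n), h]))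
      (ShortComplex.isoMk (Iso.refl _) ((HomologicalComplex.eval _ _ n).mapIso e) (Iso.refl _)
        ?_ ?_) (hc n)
    · simp
    · simp [reassoc_of% (he n)]
  · rw [Category.assoc, ← reassoc_of% (hd n), ← e.hom.comm, ← Category.assoc,
      ← HomologicalComplex.comp_f, e.inv_hom_id]
    simp

lemma acyclicCone_of_mappingCone (S : ExactStructure E)
    (𝒦 : ObjectProperty (HomotopyCategory E (ComplexShape.up ℤ))) {K L : 𝒦.FullSubcategory}
    (f : K.obj.as ⟶ L.obj.as)
    (h : 𝒦 ((HomotopyCategory.quotient _ _).obj (CochainComplex.mappingCone f)))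
    (h' : S.IsAcyclic (CochainComplex.mappingCone f)) :
    S.acyclicCone 𝒦 (ObjectProperty.homMk ((HomotopyCategory.quotient _ _).map f) : K ⟶ L) :=
  ⟨_, _, _, HomotopyCategory.mappingCone_triangleh_distinguished f, h, h'⟩

/-- K-projective complexes are colocal with respect to the morphisms with acyclic cone. -/
lemma isColocal_acyclicCone (𝒦 : ObjectProperty (HomotopyCategory B (ComplexShape.up ℤ)))
    (K : 𝒦.FullSubcategory) [CochainComplex.IsKProjective K.obj.as] :
    ((ofAbelian B).acyclicCone 𝒦).isColocal K := by
  have h : (HomotopyCategory.subcategoryAcyclic B).trW.isColocal K.obj := by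
    rw [ObjectProperty.isColocal_trW]
    exact CochainComplex.IsKProjective.leftOrthogonal K.obj.as
  intro X Y f hf
  have hle : 𝒦 ⊓ (ofAbelian B).acyclic ≤ HomotopyCategory.subcategoryAcyclic B := fun C hC =>
    (HomotopyCategory.quotient_obj_mem_subcategoryAcyclic_iff_acyclic C.as).2
      (IsAcyclic.acyclic hC.2)
  have hb := h f.hom (ObjectProperty.trW_monotone hle _ hf)
  refine ⟨fun a b hab => ?_, fun a => ?_⟩
  · ext
    exact hb.1 (congrArg (·.hom) hab)
  · obtain ⟨b, hb⟩ := hb.2 a.hom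
    exact ⟨ObjectProperty.homMk b, by ext; exact hb⟩

variable {S : ExactStructure E} {P : ObjectProperty E} {F : E ⥤ B}

namespace IsProjectiveEmbedding

/-- Classes `𝒦` and `𝒦'` of complexes that correspond to each other under `F` have equivalent
localizations if every complex in `𝒦'` has a resolution by the image of a complex in `𝒦` with terms
in `P`. The colocal objects that witness the equivalence are the complexes with terms in `P`. -/
lemma isEquivalence_localizedFunctor [F.Additive] (hF : S.IsProjectiveEmbedding P F)
    (hE : IsWeaklyIdempotentSplit E) (hP : S.IsProjectivelyGenerating P)
    {𝒦 : ObjectProperty (HomotopyCategory E (ComplexShape.up ℤ))}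
    {𝒦' : ObjectProperty (HomotopyCategory B (ComplexShape.up ℤ))}
    (h : ∀ K, 𝒦 K → 𝒦' ((F.mapHomotopyCategory (ComplexShape.up ℤ)).obj K))
    (h𝒦 : 𝒦 ≤ boundedAboveComplexes E)
    (hcone : ∀ {K L : CochainComplex E ℤ} (f : K ⟶ L),
      𝒦 ((HomotopyCategory.quotient _ _).obj K) → 𝒦 ((HomotopyCategory.quotient _ _).obj L) →
        𝒦 ((HomotopyCategory.quotient _ _).obj (CochainComplex.mappingCone f)))
    (hcone' : ∀ {K L : CochainComplex B ℤ} (f : K ⟶ L),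
      𝒦' ((HomotopyCategory.quotient _ _).obj K) → 𝒦' ((HomotopyCategory.quotient _ _).obj L) →
        𝒦' ((HomotopyCategory.quotient _ _).obj (CochainComplex.mappingCone f)))
    (hres : ∀ X : CochainComplex B ℤ, 𝒦' ((HomotopyCategory.quotient _ _).obj X) →
      ∃ (K : CochainComplex E ℤ)
        (f : (F.mapHomologicalComplex (ComplexShape.up ℤ)).obj K ⟶ X), (∀ n, P (K.X n)) ∧
        𝒦 ((HomotopyCategory.quotient _ _).obj K) ∧
        (ofAbelian B).IsAcyclic (CochainComplex.mappingCone f)) :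
    ((hF.exact.localizerMorphism h).localizedFunctor
      (S.acyclicCone 𝒦).Q ((ofAbelian B).acyclicCone 𝒦').Q).IsEquivalence := by
  have := hF.full
  have := hF.faithful
  let Φ := hF.exact.localizerMorphism h
  have : Φ.functor.Full :=
    inferInstanceAs (𝒦'.lift (𝒦.ι ⋙ F.mapHomotopyCategory (ComplexShape.up ℤ)) _).Full
  have : Φ.functor.Faithful :=
    inferInstanceAs (𝒦'.lift (𝒦.ι ⋙ F.mapHomotopyCategory (ComplexShape.up ℤ)) _).Faithful
  refine Φ.isEquivalence_localizedFunctor_of_isColocal (fun K => ∀ n, P (K.obj.as.X n))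
    (fun K hK => ?_) (fun X => ?_) (fun X => ?_)
  · obtain ⟨b, hb⟩ := h𝒦 _ K.property
    have : ∀ n, Projective
        (((F.mapHomologicalComplex (ComplexShape.up ℤ)).obj K.obj.as).X n) :=
      fun n => hF.projective _ (hK n)
    have : CochainComplex.IsStrictlyLE
        ((F.mapHomologicalComplex (ComplexShape.up ℤ)).obj K.obj.as) b := by
      rw [CochainComplex.isStrictlyLE_iff]
      exact fun n hn => F.map_isZero (hb n hn)
    have : CochainComplex.IsKProjective (Φ.functor.obj K).obj.as :=
      CochainComplex.isKProjective_of_projective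
        ((F.mapHomologicalComplex (ComplexShape.up ℤ)).obj K.obj.as) b
    exact isColocal_acyclicCone 𝒦' (Φ.functor.obj K)
  · obtain ⟨K, f, hK, hK', hf⟩ := hres _ (h _ X.property)
    obtain ⟨g, rfl⟩ := (F.mapHomologicalComplex (ComplexShape.up ℤ)).map_surjective f
    have hg := hcone g hK' X.property
    refine ⟨⟨_, hK'⟩, _, hK, S.acyclicCone_of_mappingCone 𝒦 (K := ⟨_, hK'⟩) g hg ?_⟩
    obtain ⟨b, hb⟩ := h𝒦 _ hg
    refine hF.isAcyclic hE hP _ (b + 1) (fun n hn => hb n (by lia)) fun n => ?_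
    exact (IsAcyclic.acyclic hf n).of_iso
      (CochainComplex.mappingCone.mapHomologicalComplexIso g F).symm
  · obtain ⟨K, f, hK, hK', hf⟩ := hres X.obj.as X.property
    exact ⟨⟨_, hK'⟩, _, hK, acyclicCone_of_mappingCone _ 𝒦' (K := Φ.functor.obj ⟨_, hK'⟩) f
      (hcone' f (h _ hK') X.property) hf⟩

/-- Resolutions in `B` by complexes in `E` with terms in `P`. If `P` is idempotent split, every
projective object of `B` comes from `P`, so that the resolutions of bounded complexes are bounded
when the global dimension of `B` is finite. -/
lemma exists_resolution (hF : S.IsProjectiveEmbedding P F)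
    (hP : S.IsProjectivelyGenerating P) [F.Additive]
    (X : CochainComplex B ℤ)
    (hX : boundedAboveComplexes B ((HomotopyCategory.quotient _ _).obj X)) :
    ∃ (K : CochainComplex E ℤ)
      (f : (F.mapHomologicalComplex (ComplexShape.up ℤ)).obj K ⟶ X), (∀ n, P (K.X n)) ∧
      boundedAboveComplexes E ((HomotopyCategory.quotient _ _).obj K) ∧
      (ofAbelian B).IsAcyclic (CochainComplex.mappingCone f) ∧
      (IsIdempotentComplete P.FullSubcategory → HasFiniteGlobalDimension B →
        boundedComplexes B ((HomotopyCategory.quotient _ _).obj X) →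
        boundedComplexes E ((HomotopyCategory.quotient _ _).obj K)) := by
  have := hF.full
  have := hF.faithful
  obtain ⟨b, hb⟩ := hX
  let 𝒬 : ObjectProperty B := P.map F
  have h𝒬₀ : 𝒬 0 := by
    obtain ⟨X, hX, ⟨e⟩⟩ := hP.zero
    exact ⟨X, hX, ⟨(F.map_isZero ((isZero_zero E).of_iso e.symm)).iso (isZero_zero B)⟩⟩
  have h𝒬 : ∀ Z, 𝒬 Z → Projective Z := by
    rintro Z ⟨X, hX, ⟨e⟩⟩
    have := hF.projective X hX
    exact Projective.of_iso e this
  obtain ⟨L, f, hL, hL', hf, hfin⟩ := CochainComplex.exists_resolution 𝒬 h𝒬₀ h𝒬 (fun Z => by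
    obtain ⟨X, π, hX, hπ⟩ := hF.exists_epi Z
    exact ⟨_, π, ⟨X, hX, ⟨Iso.refl _⟩⟩, hπ⟩) X (b + 1) (fun n hn => hb n (by lia))
  obtain ⟨K, hK, ⟨e⟩⟩ := CochainComplex.exists_iso_mapHomologicalComplex_obj F P L hL
  have hzero : ∀ n, IsZero (L.X n) → IsZero (K.X n) := fun n hn => by
    have : IsZero (F.obj (K.X n)) :=
      hn.of_iso ((HomologicalComplex.eval _ _ n).mapIso e)
    rw [IsZero.iff_id_eq_zero] at this ⊢
    exact F.map_injective (by rw [F.map_id, this, F.map_zero])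
  refine ⟨K, e.hom ≫ f, hK, ⟨b, fun n hn => hzero n (hL' n (by lia))⟩, ?_, ?_⟩
  · let φ := CochainComplex.mappingCone.map (e.hom ≫ f) f e.hom (𝟙 X) (by simp)
    let ψ := CochainComplex.mappingCone.map f (e.hom ≫ f) e.inv (𝟙 X) (by simp)
    refine hf.of_iso ⟨ψ, φ, ?_, ?_⟩
    · rw [← CochainComplex.mappingCone.map_comp, ← CochainComplex.mappingCone.map_id]
      simp
    · rw [← CochainComplex.mappingCone.map_comp, ← CochainComplex.mappingCone.map_id]
      simp
  · rintro hidem hdim ⟨a, b', hab⟩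
    have hproj : ∀ Z, Projective Z → 𝒬 Z := fun Z hZ => by
      -- `Z` is a direct summand of the image of an object `X` of `P`
      obtain ⟨X, π, hX, hπ⟩ := hF.exists_epi Z
      let s := Projective.factorThru (𝟙 Z) π
      have hs : s ≫ π = 𝟙 Z := Projective.factorThru_comp _ _
      let p : (⟨X, hX⟩ : P.FullSubcategory) ⟶ ⟨X, hX⟩ := ObjectProperty.homMk (F.preimage (π ≫ s))
      obtain ⟨Y, i, r, hir, hri⟩ := hidem.idempotents_split _ p (by
        ext
        exact F.map_injective (by simp [p, reassoc_of% hs]))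
      have h₁ : F.map i.hom ≫ F.map r.hom = 𝟙 _ := by
        rw [← F.map_comp, ← ObjectProperty.FullSubcategory.comp_hom, hir]
        simp
      have h₂ : F.map r.hom ≫ F.map i.hom = π ≫ s := by
        rw [← F.map_comp, ← ObjectProperty.FullSubcategory.comp_hom, hri]
        simp [p]
      refine ⟨Y.obj, Y.property, ⟨⟨F.map i.hom ≫ π, s ≫ F.map r.hom, ?_, ?_⟩⟩⟩
      · rw [Category.assoc, ← reassoc_of% h₂, h₁, reassoc_of% h₁]
      · rw [Category.assoc, reassoc_of% h₂, reassoc_of% hs, hs]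
    obtain ⟨a', ha'⟩ := hfin hproj hdim ⟨a, fun n hn => hab n (Or.inl hn)⟩
    exact ⟨a', b, fun n hn => hzero n (hn.elim (ha' n) fun hn => hL' n (by lia))⟩

theorem mapBoundedAboveDerivedCategory_isEquivalence (hF : S.IsProjectiveEmbedding P F)
    (hE : IsWeaklyIdempotentSplit E) (hP : S.IsProjectivelyGenerating P) :
    hF.exact.mapBoundedAboveDerivedCategory.IsEquivalence := by
  have := hF.exact.additive
  refine hF.isEquivalence_localizedFunctor hE hP (boundedAboveComplexes_map F) le_rfl
    boundedAboveComplexes_mappingCone boundedAboveComplexes_mappingCone fun X hX => ?_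
  obtain ⟨K, f, hK, hK', hf, _⟩ := hF.exists_resolution hP X hX
  exact ⟨K, f, hK, hK', hf⟩

theorem mapBoundedDerivedCategory_isEquivalence (hF : S.IsProjectiveEmbedding P F)
    (hE : IsWeaklyIdempotentSplit E) (hP : S.IsProjectivelyGenerating P)
    (hidem : IsIdempotentComplete P.FullSubcategory) (hdim : HasFiniteGlobalDimension B) :
    hF.exact.mapBoundedDerivedCategory.IsEquivalence := by
  have := hF.exact.additive
  refine hF.isEquivalence_localizedFunctor hE hP (boundedComplexes_map F)
    (fun K ⟨_, b, hb⟩ => ⟨b, fun n hn => hb n (Or.inr hn)⟩)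
    boundedComplexes_mappingCone boundedComplexes_mappingCone fun X hX => ?_
  obtain ⟨K, f, hK, _, hf, hfin⟩ := hF.exists_resolution hP X
    (by obtain ⟨_, b, hb⟩ := hX; exact ⟨b, fun n hn => hb n (Or.inr hn)⟩)
  exact ⟨K, f, hK, hfin hidem hdim hX, hf⟩

end IsProjectiveEmbedding

end ExactStructure

end

/-! ### Coherent objects in an abelian category -/

namespace CategoryTheory.ObjectProperty

section

variable {C : Type u} [Category.{v} C] [Abelian C]

/-- An object is finitely generated with respect to a class `𝒢` of objects if it is a quotient of an
object of `𝒢`. -/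
def FinitelyGenerated (𝒢 : ObjectProperty C) : ObjectProperty C :=
  fun X => ∃ (p : C) (π : p ⟶ X), 𝒢 p ∧ Epi π

/-- An object `X` is coherent with respect to a class `𝒢` of objects if it is finitely generated and
the kernels of all morphisms from objects of `𝒢` to `X` are finitely generated. -/
def Coherent (𝒢 : ObjectProperty C) : ObjectProperty C :=
  fun X => 𝒢.FinitelyGenerated X ∧ ∀ (p : C) (f : p ⟶ X), 𝒢 p → 𝒢.FinitelyGenerated (kernel f)

variable {𝒢 : ObjectProperty C}

omit [Abelian C] in
lemma FinitelyGenerated.of_epi {X Y : C} (hX : 𝒢.FinitelyGenerated X) (f : X ⟶ Y) [Epi f] :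
    𝒢.FinitelyGenerated Y := by
  obtain ⟨p, π, hp, _⟩ := hX
  exact ⟨p, π ≫ f, hp, inferInstance⟩

/-- A finitely generated object surjects onto a kernel if it does so locally. -/
lemma FinitelyGenerated.kernel_of_refinements {X Y Z : C} (hX : 𝒢.FinitelyGenerated X)
    (a : X ⟶ Y) (g : Y ⟶ Z) (hag : a ≫ g = 0)
    (h : ∀ ⦃T : C⦄ (t : T ⟶ Y), t ≫ g = 0 →
      ∃ (T' : C) (π : T' ⟶ T) (_ : Epi π) (s : T' ⟶ X), π ≫ t = s ≫ a) :
    𝒢.FinitelyGenerated (kernel g) := by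
  have : Epi (kernel.lift g a hag) := by
    obtain ⟨T', π, _, s, hs⟩ := h (kernel.ι g) (kernel.condition g)
    have : s ≫ kernel.lift g a hag = π := by
      rw [← cancel_mono (kernel.ι g), Category.assoc, kernel.lift_ι, hs]
    have : Epi (s ≫ kernel.lift g a hag) := by rwa [this]
    exact epi_of_epi s _
  exact hX.of_epi (kernel.lift g a hag)

instance [𝒢.IsClosedUnderIsomorphisms] : 𝒢.Coherent.IsClosedUnderIsomorphisms where
  of_iso e hX := ⟨hX.1.of_epi e.hom, fun p f hp =>
    (hX.2 p (f ≫ e.inv) hp).of_epi (kernelCompMono f e.inv).hom⟩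

instance : 𝒢.Coherent.IsClosedUnderKernels where
  kernels_le := by
    rintro _ ⟨f, k, hk, hX, hY⟩
    refine ⟨?_, fun p g hp => ?_⟩
    · obtain ⟨p, π, hp, hπ⟩ := hX.1
      have : 𝒢.FinitelyGenerated (kernel f) := by
        refine (hY.2 p (π ≫ f) hp).kernel_of_refinements (kernel.ι (π ≫ f) ≫ π) f (by simp) ?_
        intro T t ht
        obtain ⟨T', π', hπ', s, hs⟩ := surjective_up_to_refinements_of_epi π t
        exact ⟨T', π', hπ', kernel.lift _ s (by rw [← reassoc_of% hs, ht, comp_zero]),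
          by simp [hs]⟩
      exact this.of_epi ((kernelIsKernel f).conePointUniqueUpToIso hk).hom
    · have : Mono k.ι := Fork.IsLimit.mono hk
      exact (hX.2 p (g ≫ k.ι) hp).of_epi (kernelCompMono g k.ι).hom

section

variable (h𝒢 : ∀ p q, 𝒢 p → 𝒢 q → 𝒢 (p ⊞ q))

include h𝒢

lemma Coherent.isClosedUnderCokernels (hproj : ∀ p, 𝒢 p → Projective p) :
    𝒢.Coherent.IsClosedUnderCokernels where
  cokernels_le := by
    rintro _ ⟨f, k, hk, hX, hY⟩
    have hπ : Epi k.π := Cofork.IsColimit.epi hk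
    have hex : (ShortComplex.mk f k.π (CokernelCofork.condition k)).Exact :=
      ShortComplex.exact_of_g_is_cokernel _
        (IsColimit.ofIsoColimit hk (Cofork.ext (Iso.refl _) (by simp)))
    refine ⟨hY.1.of_epi k.π, fun p g hp => ?_⟩
    have := hproj p hp
    obtain ⟨q, ρ, hq, hρ⟩ := hX.1
    let g' := Projective.factorThru g k.π
    have hg' : g' ≫ k.π = g := Projective.factorThru_comp _ _
    let h := biprod.desc g' (ρ ≫ f)
    have hfst : (kernel.ι h ≫ biprod.fst) ≫ g = 0 := by
      have hh : kernel.ι h ≫ h = 0 := kernel.condition h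
      have e : biprod.fst ≫ g = h ≫ k.π := by
        ext
        · simp [h, hg']
        · simp [h, CokernelCofork.condition k]
      rw [Category.assoc, e, reassoc_of% hh, zero_comp]
    refine (hY.2 _ h (h𝒢 p q hp hq)).kernel_of_refinements _ g hfst fun T t ht => ?_
    obtain ⟨T₁, π₁, _, x, hx⟩ := hex.exact_up_to_refinements (t ≫ g') (by simp [hg', ht])
    obtain ⟨T₂, π₂, _, y, hy⟩ := surjective_up_to_refinements_of_epi ρ x
    dsimp at hx
    have hs : biprod.lift (π₂ ≫ π₁ ≫ t) (-y) ≫ h = 0 := by simp [h, hx, reassoc_of% hy]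
    exact ⟨T₂, π₂ ≫ π₁, inferInstance, kernel.lift h _ hs, by simp⟩

lemma Coherent.isClosedUnderBinaryProducts [𝒢.IsClosedUnderIsomorphisms] :
    𝒢.Coherent.IsClosedUnderBinaryProducts := by
  have key : ∀ X Y, 𝒢.Coherent X → 𝒢.Coherent Y → 𝒢.Coherent (X ⊞ Y) := by
    intro X Y hX hY
    obtain ⟨p, π, hp, _⟩ := hX.1
    obtain ⟨q, ρ, hq, _⟩ := hY.1
    refine ⟨⟨p ⊞ q, biprod.map π ρ, h𝒢 p q hp hq, inferInstance⟩, fun p f hp => ?_⟩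
    obtain ⟨r, σ, hr, _⟩ := hX.2 p (f ≫ biprod.fst) hp
    let a := σ ≫ kernel.ι (f ≫ biprod.fst)
    have ha : a ≫ f ≫ biprod.fst = 0 := by simp [a]
    refine (hY.2 r (a ≫ f ≫ biprod.snd) hr).kernel_of_refinements (kernel.ι _ ≫ a) f ?_ ?_
    · ext
      · simp [ha]
      · simp
    · intro T t ht
      obtain ⟨T', π', hπ', s, hs⟩ := surjective_up_to_refinements_of_epi σ
        (kernel.lift (f ≫ biprod.fst) t (by rw [reassoc_of% ht, zero_comp]))
      have hsa : s ≫ a = π' ≫ t := by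
        simp only [a]
        rw [← reassoc_of% hs, kernel.lift_ι]
      exact ⟨T', π', hπ', kernel.lift _ s (by rw [reassoc_of% hsa, reassoc_of% ht]; simp),
        by simp [hsa]⟩
  refine ⟨fun X ⟨p⟩ => ?_⟩
  have e : X ≅ p.diag.obj ⟨.left⟩ ⊞ p.diag.obj ⟨.right⟩ :=
    (p.isLimit.conePointUniqueUpToIso (limit.isLimit _)).trans
      ((HasLimit.isoOfNatIso (diagramIsoPair p.diag)).trans (biprod.isoProd _ _).symm)
  exact 𝒢.Coherent.prop_of_iso e.symm (key _ _ (p.prop_diag_obj _) (p.prop_diag_obj _))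

end

lemma le_coherent (h : ∀ ⦃p q : C⦄ (f : p ⟶ q), 𝒢 p → 𝒢 q → 𝒢.FinitelyGenerated (kernel f)) :
    𝒢 ≤ 𝒢.Coherent :=
  fun p hp => ⟨⟨p, 𝟙 p, hp, inferInstance⟩, fun _ f hq => h f hq hp⟩

/-- The coherent objects with respect to a class of projectives that is closed under finite direct
sums form an abelian category. -/
noncomputable abbrev Coherent.abelian [𝒢.IsClosedUnderIsomorphisms] (h₀ : 𝒢 0)
    (h𝒢 : ∀ p q, 𝒢 p → 𝒢 q → 𝒢 (p ⊞ q)) (hproj : ∀ p, 𝒢 p → Projective p) :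
    Abelian 𝒢.Coherent.FullSubcategory := by
  have := Coherent.isClosedUnderCokernels h𝒢 hproj
  have := Coherent.isClosedUnderBinaryProducts h𝒢
  have : 𝒢.Coherent.ContainsZero := ⟨0, isZero_zero C, ⟨0, 0, h₀, inferInstance⟩, fun p f hp => by
    obtain rfl : f = 0 := (isZero_zero C).eq_of_tgt _ _
    exact ⟨p, inv (kernel.ι 0), hp, inferInstance⟩⟩
  have : 𝒢.Coherent.IsClosedUnderFiniteProducts := IsClosedUnderFiniteProducts.mk'
  infer_instance

end

end CategoryTheory.ObjectProperty

/-! ### Additive functors and the restricted Yoneda functor -/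

namespace CategoryTheory

open Opposite

section

variable (K : Type u) [Category.{v} K] [Preadditive K] (A : Type u') [Category.{v'} A] [Abelian A]

instance : (additiveFunctor K A).ContainsZero :=
  ⟨0, isZero_zero _, ⟨fun {_ _ _ _} => (Functor.zero_obj (C := K) (D := A) _).eq_of_src _ _⟩⟩

instance : (additiveFunctor K A).IsClosedUnderSubobjects where
  prop_of_mono {F G} i _ hG := ⟨fun {X Y f g} => by
    have : G.Additive := hG
    have := (NatTrans.mono_iff_mono_app i).1 inferInstance Y
    rw [← cancel_mono (i.app Y), Preadditive.add_comp]
    simp only [NatTrans.naturality, G.map_add, Preadditive.comp_add]⟩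

instance : (additiveFunctor K A).IsClosedUnderQuotients where
  prop_of_epi {F G} q _ hF := ⟨fun {X Y f g} => by
    have : F.Additive := hF
    have := (NatTrans.epi_iff_epi_app q).1 inferInstance X
    rw [← cancel_epi (q.app X), Preadditive.comp_add]
    simp only [← NatTrans.naturality, F.map_add, Preadditive.add_comp]⟩

instance : (additiveFunctor K A).IsClosedUnderFiniteProducts where
  isClosedUnderLimitsOfShape J _ := ⟨fun F ⟨p⟩ => ⟨fun {X Y f g} => by
    have : HasLimitsOfShape (Discrete J) A := hasLimitsOfShape_discrete _ _
    refine (isLimitOfPreserves ((evaluation K A).obj Y) p.isLimit).hom_ext fun j => ?_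
    have : (p.diag.obj j).Additive := p.prop_diag_obj j
    change F.map (f + g) ≫ (p.π.app j).app Y = (F.map f + F.map g) ≫ (p.π.app j).app Y
    rw [Preadditive.add_comp]
    simp only [NatTrans.naturality]
    simp [Functor.map_add, Preadditive.comp_add]⟩⟩

end

section

variable {E : Type u} [Category.{v} E] [Preadditive E] (P : ObjectProperty E)

/-- The restricted Yoneda functor: an object `X` is sent to the functor `Hom(-, X)` on the full
subcategory `P`. -/
def restrictedYoneda : E ⥤ (P.FullSubcategoryᵒᵖ ⥤+ AddCommGrpCat.{v}) :=
  ObjectProperty.lift _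
    (preadditiveYoneda ⋙ (Functor.whiskeringLeft _ _ AddCommGrpCat.{v}).obj P.ι.op)
    fun X => inferInstanceAs (P.ι.op ⋙ preadditiveYoneda.obj X).Additive

namespace restrictedYoneda

/-- The elements of the value of `restrictedYoneda P` at `X` are the morphisms to `X`. -/
def elem {X : E} {q : P.FullSubcategory} (f : q.obj ⟶ X) :
    ((restrictedYoneda P).obj X).obj.obj (op q) := f

variable {P}

variable {H : P.FullSubcategoryᵒᵖ ⥤+ AddCommGrpCat.{v}} {p : P.FullSubcategory}

/-- The morphism from a representable functor that corresponds to an element by the Yoneda lemma. -/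
def ofElem (x : H.obj.obj (op p)) : (restrictedYoneda P).obj p.obj ⟶ H :=
  ObjectProperty.homMk
    { app := fun q => AddCommGrpCat.ofHom
        (AddMonoidHom.mk' (fun f : q.unop.obj ⟶ p.obj =>
            H.obj.map (ObjectProperty.homMk f : q.unop ⟶ p).op x)
          fun f g => by
            have : (ObjectProperty.homMk (f + g) : q.unop ⟶ p).op =
              (ObjectProperty.homMk f : q.unop ⟶ p).op +
                (ObjectProperty.homMk g : q.unop ⟶ p).op := rfl
            rw [this, H.obj.map_add]
            rfl)
      naturality := fun q r g => by
        ext f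
        change H.obj.map (ObjectProperty.homMk (g.unop.hom ≫ f) : r.unop ⟶ p).op x =
          H.obj.map g (H.obj.map (ObjectProperty.homMk f : q.unop ⟶ p).op x)
        rw [← ConcreteCategory.comp_apply, ← H.obj.map_comp]
        rfl }

lemma ofElem_app (x : H.obj.obj (op p)) {q : P.FullSubcategory} (f : q ⟶ p) :
    (ofElem x).hom.app (op q) (elem P f.hom) = H.obj.map f.op x := rfl

lemma hom_ext {X : E} {s t : (restrictedYoneda P).obj X ⟶ H}
    (h : ∀ (q : P.FullSubcategory) (f : q.obj ⟶ X),
      s.hom.app (op q) (elem P f) = t.hom.app (op q) (elem P f)) : s = t := by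
  ext q f
  exact h q.unop f

lemma app_elem {X : E} (s : (restrictedYoneda P).obj X ⟶ H) {q r : P.FullSubcategory}
    (g : r ⟶ q) (f : q.obj ⟶ X) :
    s.hom.app (op r) (elem P (g.hom ≫ f)) = H.obj.map g.op (s.hom.app (op q) (elem P f)) :=
  ConcreteCategory.congr_hom (s.hom.naturality g.op) (elem P f)

/-- The uniqueness part of the Yoneda lemma. -/
lemma hom_ext' {s t : (restrictedYoneda P).obj p.obj ⟶ H}
    (h : s.hom.app (op p) (elem P (𝟙 p.obj)) = t.hom.app (op p) (elem P (𝟙 p.obj))) : s = t :=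
  hom_ext fun q f => by
    have := app_elem s (ObjectProperty.homMk f : q ⟶ p) (𝟙 p.obj)
    have h' := app_elem t (ObjectProperty.homMk f : q ⟶ p) (𝟙 p.obj)
    simp only [ObjectProperty.homMk_hom, Category.comp_id] at this h'
    rw [this, h', h]

lemma ofElem_app_id (x : H.obj.obj (op p)) :
    (ofElem x).hom.app (op p) (elem P (𝟙 p.obj)) = x := by
  have := ofElem_app x (𝟙 p)
  simpa using this

/-- The restricted Yoneda functor is full on the objects of `P`. -/
lemma exists_map_eq {q : P.FullSubcategory}
    (s : (restrictedYoneda P).obj p.obj ⟶ (restrictedYoneda P).obj q.obj) :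
    ∃ f : p ⟶ q, (restrictedYoneda P).map f.hom = s :=
  ⟨ObjectProperty.homMk (s.hom.app (op p) (elem P (𝟙 p.obj))), hom_ext' (Category.id_comp _)⟩

/-- The restricted Yoneda functor is faithful on the objects of `P`. -/
lemma map_injective {q : P.FullSubcategory} {f g : p ⟶ q}
    (h : (restrictedYoneda P).map f.hom = (restrictedYoneda P).map g.hom) : f = g := by
  ext
  rw [← Category.id_comp f.hom, ← Category.id_comp g.hom]
  exact congr($(h).hom.app (op p) (elem P (𝟙 p.obj)))

lemma epi_iff {G : P.FullSubcategoryᵒᵖ ⥤+ AddCommGrpCat.{v}} (e : G ⟶ H) :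
    Epi e ↔ ∀ (q : P.FullSubcategory), Function.Surjective (e.hom.app (op q)) := by
  constructor
  · intro he q
    have := (additiveFunctor P.FullSubcategoryᵒᵖ
      AddCommGrpCat.{v}).preservesEpimorphisms_ι_of_isNormalMonoCategory
    have : Epi e.hom := inferInstanceAs (Epi ((ObjectProperty.ι _).map e))
    have := (NatTrans.epi_iff_epi_app e.hom).1 this (op q)
    exact (AddCommGrpCat.epi_iff_surjective _).1 this
  · intro h
    have : Epi ((ObjectProperty.ι _).map e) := (NatTrans.epi_iff_epi_app e.hom).2
      fun q => (AddCommGrpCat.epi_iff_surjective _).2 (h q.unop)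
    exact (ObjectProperty.ι _).epi_of_epi_map this

/-- Epimorphisms of additive functors are detected by the representable functors. -/
lemma epi_of_lift {G : P.FullSubcategoryᵒᵖ ⥤+ AddCommGrpCat.{v}} (e : G ⟶ H)
    (h : ∀ (q : P.FullSubcategory) (t : (restrictedYoneda P).obj q.obj ⟶ H), ∃ s, s ≫ e = t) :
    Epi e :=
  (epi_iff e).2 fun q x => by
    obtain ⟨s, hs⟩ := h q (ofElem x)
    exact ⟨s.hom.app (op q) (elem P (𝟙 _)), by rw [← ofElem_app_id x, ← hs]; rfl⟩

instance projective (p : P.FullSubcategory) : Projective ((restrictedYoneda P).obj p.obj) where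
  factors {G H} t e he := by
    obtain ⟨y, hy⟩ := (epi_iff e).1 he p (t.hom.app (op p) (elem P (𝟙 _)))
    exact ⟨ofElem y, hom_ext' (by
      rw [← hy]
      exact congrArg (e.hom.app (op p)) (ofElem_app_id y))⟩

end restrictedYoneda

instance : (restrictedYoneda P).Additive where
  map_add := restrictedYoneda.hom_ext fun _ _ => Preadditive.comp_add _ _ _ _ _ _

end

end CategoryTheory

/-! ### The embedding into coherent functors on the projectives -/

namespace ExactStructure

open Opposite

section

variable {E : Type u} [Category.{v} E] [Preadditive E] [HasZeroObject E] [HasBinaryBiproducts E]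
  {S : ExactStructure E} {P : ObjectProperty E}

lemma IsProjective.exists_lift {Q Y Z : E} (hQ : S.IsProjective Q) {d : Y ⟶ Z}
    (hd : S.IsDeflation d) (f : Q ⟶ Z) : ∃ t : Q ⟶ Y, t ≫ d = f := by
  obtain ⟨_, _, _, hc⟩ := hd
  have := (hQ.map_conflation _ hc).epi_g
  exact (AddCommGrpCat.epi_iff_surjective _).1 this f

variable {B : Type u'} [Category.{v'} B] [Abelian B]

/-- A fully faithful additive functor is exact as soon as the images of the objects of `P` detect
epimorphisms: by full faithfulness, maps out of these images are maps in the exact category, where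
`Hom(Q, -)` is exact for `Q` in `P`. -/
lemma IsProjectivelyGenerating.isExactFunctor (hP : S.IsProjectivelyGenerating P) (F : E ⥤ B)
    [F.Additive] [F.Full] [F.Faithful]
    (hF : ∀ ⦃G H : B⦄ (e : G ⟶ H), (∀ Q, P Q → ∀ t : F.obj Q ⟶ H, ∃ s, s ≫ e = t) → Epi e) :
    S.IsExactFunctor (ofAbelian B) F where
  additive := inferInstance
  map_conflation T hT := by
    obtain ⟨hi⟩ := S.isKernel hT
    have hiT : Mono T.f := Fork.IsLimit.mono hi
    have w : F.map T.f ≫ F.map T.g = 0 := by rw [← F.map_comp, T.zero, F.map_zero]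
    have hex : Epi (kernel.lift (F.map T.g) (F.map T.f) w) := by
      refine hF _ fun Q hQ t => ?_
      obtain ⟨t', ht'⟩ := F.map_surjective (t ≫ kernel.ι (F.map T.g))
      obtain ⟨s, hs⟩ : ∃ s, s ≫ T.f = t' := by
        obtain ⟨s, hs⟩ := KernelFork.IsLimit.lift' hi t' (F.map_injective (by
          rw [F.map_comp, ht', Category.assoc, kernel.condition, comp_zero, F.map_zero]))
        exact ⟨s, hs⟩
      refine ⟨F.map s, ?_⟩
      rw [← cancel_mono (kernel.ι (F.map T.g)), Category.assoc, kernel.lift_ι, ← F.map_comp, hs,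
        ht']
    have hmono : Mono (F.map T.f) := by
      refine Preadditive.mono_of_cancel_zero _ fun {G} g hg => ?_
      have : Epi (kernel.ι g) := hF _ fun Q hQ t => by
        obtain ⟨t', ht'⟩ := F.map_surjective (t ≫ g)
        refine ⟨kernel.lift g t ?_, kernel.lift_ι _ _ _⟩
        suffices t' = 0 by rw [← ht', this, F.map_zero]
        rw [← cancel_mono T.f, zero_comp]
        apply F.map_injective
        rw [F.map_comp, ht', F.map_zero, Category.assoc, hg, comp_zero]
      rw [← cancel_epi (kernel.ι g), kernel.condition, comp_zero]
    have hepi : Epi (F.map T.g) := by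
      refine hF _ fun Q hQ t => ?_
      obtain ⟨t', ht'⟩ := F.map_surjective t
      obtain ⟨s, hs⟩ := (hP.isProjective Q hQ).exists_lift ⟨_, _, _, hT⟩ t'
      exact ⟨F.map s, by rw [← F.map_comp, hs, ht']⟩
    exact { exact := (ShortComplex.exact_iff_epi_kernel_lift _).2 hex
            mono_f := hmono
            epi_g := hepi }

/-- Exactness is automatic in the definition of a projective embedding. -/
lemma IsProjectivelyGenerating.isProjectiveEmbedding (hP : S.IsProjectivelyGenerating P)
    (F : E ⥤ B) [F.Additive] [hfull : F.Full] [hfaith : F.Faithful]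
    (hproj : ∀ X, P X → Projective (F.obj X))
    (hepi : ∀ b : B, ∃ (X : E) (π : F.obj X ⟶ b), P X ∧ Epi π) :
    S.IsProjectiveEmbedding P F where
  exact := hP.isExactFunctor F fun G H e he => by
    obtain ⟨X, π, hX, hπ⟩ := hepi H
    obtain ⟨s, hs⟩ := he X hX π
    have : Epi (s ≫ e) := by rwa [hs]
    exact epi_of_epi s e
  full := hfull
  faithful := hfaith
  projective := hproj
  exists_epi := hepi

lemma IsProjectiveEmbedding.comp_equivalence (hP : S.IsProjectivelyGenerating P) {F : E ⥤ B}
    (hF : S.IsProjectiveEmbedding P F) {B' : Type w} [Category.{w'} B'] [Abelian B'] (e : B ≌ B') :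
    S.IsProjectiveEmbedding P (F ⋙ e.functor) := by
  have := hF.full
  have := hF.faithful
  have := hF.exact.additive
  have := e.functor.additive_of_preserves_binary_products
  refine hP.isProjectiveEmbedding _ (fun X hX => ?_) fun b => ?_
  · exact (e.map_projective_iff _).2 (hF.projective X hX)
  · obtain ⟨X, π, hX, hπ⟩ := hF.exists_epi (e.inverse.obj b)
    exact ⟨X, e.functor.map π ≫ e.counit.app b, hX, inferInstance⟩

namespace IsProjectivelyGenerating

variable (hP : S.IsProjectivelyGenerating P)
include hP

lemma faithful_restrictedYoneda : (restrictedYoneda P).Faithful where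
  map_injective {X Y f g} h := by
    obtain ⟨Q, d, hQ, hd⟩ := hP.exists_deflation X
    have := hd.epi
    rw [← cancel_epi d]
    exact congr($(h).hom.app (op ⟨Q, hQ⟩) (restrictedYoneda.elem P (q := ⟨Q, hQ⟩) d))

/-- A morphism between restricted representable functors is given by a morphism `X ⟶ Y` because `X`
is the cokernel of a morphism between objects of `P`. -/
lemma full_restrictedYoneda : (restrictedYoneda P).Full where
  map_surjective {X Y} φ := by
    let α : ∀ q : P.FullSubcategory, (q.obj ⟶ X) → (q.obj ⟶ Y) :=
      fun q f => φ.hom.app (op q) (restrictedYoneda.elem P f)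
    have hα : ∀ (q r : P.FullSubcategory) (g : r ⟶ q) (f : q.obj ⟶ X),
        α r (g.hom ≫ f) = g.hom ≫ α q f := fun q r g f => restrictedYoneda.app_elem φ g f
    have hα₀ : ∀ q, α q 0 = 0 := fun q => map_zero (φ.hom.app (op q)).hom
    obtain ⟨Q, d, hQ, X', i, w, hc⟩ := hP.exists_deflation X
    obtain ⟨Q', d', hQ', hd'⟩ := hP.exists_deflation X'
    have := hd'.epi
    obtain ⟨g, hg⟩ : ∃ g, d ≫ g = α ⟨Q, hQ⟩ d := by
      obtain ⟨g, hg⟩ := CokernelCofork.IsColimit.desc' (S.isCokernel hc).some (α ⟨Q, hQ⟩ d) (by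
        rw [← cancel_epi d', comp_zero, ← Category.assoc]
        refine (hα ⟨Q, hQ⟩ ⟨Q', hQ'⟩ (ObjectProperty.homMk (d' ≫ i)) d).symm.trans ?_
        rw [ObjectProperty.homMk_hom, Category.assoc, w, comp_zero, hα₀])
      exact ⟨g, hg⟩
    refine ⟨g, restrictedYoneda.hom_ext fun q f => ?_⟩
    obtain ⟨t, rfl⟩ := (hP.isProjective q.obj q.property).exists_lift ⟨_, _, _, hc⟩ f
    change (t ≫ d) ≫ g = α q (t ≫ d)
    exact ((Category.assoc _ _ _).trans (congrArg (t ≫ ·) hg)).trans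
      (hα ⟨Q, hQ⟩ q (ObjectProperty.homMk t) d).symm

lemma isExactFunctor_restrictedYoneda : S.IsExactFunctor (ofAbelian _) (restrictedYoneda P) := by
  have := hP.full_restrictedYoneda
  have := hP.faithful_restrictedYoneda
  exact hP.isExactFunctor _ fun G H e h =>
    restrictedYoneda.epi_of_lift e fun q t => h q.obj q.property t

end IsProjectivelyGenerating

omit [HasZeroObject E] [HasBinaryBiproducts E] in
/-- The kernel of a morphism between representable functors is a quotient of the functor that is
represented by a weak kernel. -/
lemma _root_.CategoryTheory.restrictedYoneda.finitelyGenerated_kernel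
    [HasWeakKernels P.FullSubcategory]
    ⦃G H : P.FullSubcategoryᵒᵖ ⥤+ AddCommGrpCat.{v}⦄ (f : G ⟶ H)
    (hG : P.map (restrictedYoneda P) G) (hH : P.map (restrictedYoneda P) H) :
    (P.map (restrictedYoneda P)).FinitelyGenerated (kernel f) := by
  obtain ⟨p, hp, ⟨e⟩⟩ := hG
  obtain ⟨q, hq, ⟨e'⟩⟩ := hH
  obtain ⟨p, rfl⟩ : ∃ p' : P.FullSubcategory, p'.obj = p := ⟨⟨p, hp⟩, rfl⟩
  obtain ⟨q, rfl⟩ : ∃ q' : P.FullSubcategory, q'.obj = q := ⟨⟨q, hq⟩, rfl⟩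
  obtain ⟨g, hg⟩ := restrictedYoneda.exists_map_eq (e.hom ≫ f ≫ e'.inv)
  have hg' : (restrictedYoneda P).map g.hom ≫ e'.hom = e.hom ≫ f := by simp [hg]
  have h : ((restrictedYoneda P).map (weakKernel.ι g).hom ≫ e.hom) ≫ f = 0 := by
    have : (weakKernel.ι g).hom ≫ g.hom = 0 := congr($(weakKernel.condition g).hom)
    rw [Category.assoc, ← hg', ← Functor.map_comp_assoc, this, Functor.map_zero, zero_comp]
  refine ⟨_, kernel.lift f _ h, P.prop_map_obj _ (weakKernel g).property, ?_⟩
  refine restrictedYoneda.epi_of_lift _ fun r t => ?_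
  obtain ⟨s, hs⟩ := restrictedYoneda.exists_map_eq (t ≫ kernel.ι f ≫ e.inv)
  obtain ⟨l, rfl⟩ : ∃ l, l ≫ weakKernel.ι g = s := by
    refine ⟨weakKernel.lift g s ?_, weakKernel.lift_ι g s _⟩
    apply restrictedYoneda.map_injective
    have : (restrictedYoneda P).map s.hom ≫ (restrictedYoneda P).map g.hom ≫ e'.hom = 0 := by
      simp [hg', hs]
    rw [ObjectProperty.FullSubcategory.comp_hom, Functor.map_comp, ← cancel_mono e'.hom,
      Category.assoc, this]
    simp
  refine ⟨(restrictedYoneda P).map l.hom, ?_⟩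
  rw [← cancel_mono (kernel.ι f), Category.assoc, kernel.lift_ι, ← Functor.map_comp_assoc,
    ← ObjectProperty.FullSubcategory.comp_hom, hs]
  simp

namespace IsProjectivelyGenerating

variable (hP : S.IsProjectivelyGenerating P)
include hP

lemma map_restrictedYoneda_zero : P.map (restrictedYoneda P) 0 := by
  obtain ⟨Q, hQ, ⟨e⟩⟩ := hP.zero
  exact ⟨Q, hQ, ⟨(restrictedYoneda P).mapIso e.symm ≪≫
    ((restrictedYoneda P).map_isZero (isZero_zero E)).isoZero⟩⟩

lemma map_restrictedYoneda_biprod (G H : P.FullSubcategoryᵒᵖ ⥤+ AddCommGrpCat.{v})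
    (hG : P.map (restrictedYoneda P) G) (hH : P.map (restrictedYoneda P) H) :
    P.map (restrictedYoneda P) (G ⊞ H) := by
  obtain ⟨p, hp, ⟨e⟩⟩ := hG
  obtain ⟨q, hq, ⟨e'⟩⟩ := hH
  obtain ⟨Q, hQ, ⟨e''⟩⟩ := hP.biprod p q hp hq
  have := preservesBinaryBiproducts_of_preservesBiproducts (restrictedYoneda P)
  exact ⟨Q, hQ, ⟨(restrictedYoneda P).mapIso e''.symm ≪≫
    (restrictedYoneda P).mapBiprod p q ≪≫ biprod.mapIso e e'⟩⟩

omit hP [HasZeroObject E] [HasBinaryBiproducts E] in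
lemma _root_.CategoryTheory.restrictedYoneda.projective_of_map
    (G : P.FullSubcategoryᵒᵖ ⥤+ AddCommGrpCat.{v})
    (hG : P.map (restrictedYoneda P) G) : Projective G := by
  obtain ⟨p, hp, ⟨e⟩⟩ := hG
  exact Projective.of_iso e (restrictedYoneda.projective ⟨p, hp⟩)

/-- The functor of an object `X` of the exact category is coherent, as the cokernel of a morphism
between representable functors. -/
lemma coherent_restrictedYoneda [HasWeakKernels P.FullSubcategory] (X : E) :
    (P.map (restrictedYoneda P)).Coherent ((restrictedYoneda P).obj X) := by
  have hF := hP.isExactFunctor_restrictedYoneda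
  have hc := ObjectProperty.le_coherent (𝒢 := P.map (restrictedYoneda P))
    restrictedYoneda.finitelyGenerated_kernel
  have := ObjectProperty.Coherent.isClosedUnderCokernels hP.map_restrictedYoneda_biprod
    restrictedYoneda.projective_of_map
  obtain ⟨Q, d, hQ, X', i, w, h⟩ := hP.exists_deflation X
  obtain ⟨Q', d', hQ', X'', i', w', h'⟩ := hP.exists_deflation X'
  have : Epi ((restrictedYoneda P).map d') := (hF.map_conflation _ h').epi_g
  have hcol : IsColimit (CokernelCofork.ofπ (f := (restrictedYoneda P).map i)
    ((restrictedYoneda P).map d) _) := (hF.map_conflation _ h).gIsCokernel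
  exact ObjectProperty.prop_of_isColimit_cokernelCofork _
    (isCokernelEpiComp hcol ((restrictedYoneda P).map d') rfl)
    (hc _ (P.prop_map_obj _ hQ')) (hc _ (P.prop_map_obj _ hQ))

/-- An exact category with enough projectives embeds into the abelian category of coherent
functors on the projectives. -/
lemma exists_isProjectiveEmbedding_of_hasWeakKernels [HasWeakKernels P.FullSubcategory] :
    ∃ (_ : Abelian (P.map (restrictedYoneda P)).Coherent.FullSubcategory)
      (R : E ⥤ (P.map (restrictedYoneda P)).Coherent.FullSubcategory),
      S.IsProjectiveEmbedding P R := by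
  let 𝒢 := P.map (restrictedYoneda P)
  let R : E ⥤ 𝒢.Coherent.FullSubcategory :=
    𝒢.Coherent.lift (restrictedYoneda P) hP.coherent_restrictedYoneda
  let : Abelian 𝒢.Coherent.FullSubcategory := ObjectProperty.Coherent.abelian
    hP.map_restrictedYoneda_zero hP.map_restrictedYoneda_biprod restrictedYoneda.projective_of_map
  have := ObjectProperty.Coherent.isClosedUnderCokernels hP.map_restrictedYoneda_biprod
    restrictedYoneda.projective_of_map
  have h₀ := hP.map_restrictedYoneda_zero
  have : 𝒢.Coherent.ContainsZero := ⟨0, isZero_zero _,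
    ObjectProperty.le_coherent restrictedYoneda.finitelyGenerated_kernel _ h₀⟩
  have := 𝒢.Coherent.preservesEpimorphisms_ι_of_isNormalMonoCategory
  have := hP.full_restrictedYoneda
  have := hP.faithful_restrictedYoneda
  have : R.Additive := ⟨by
    intro X Y f g
    ext1
    exact (restrictedYoneda P).map_add⟩
  refine ⟨inferInstance, R, hP.isProjectiveEmbedding R (fun X hX => ?_) fun b => ?_⟩
  · exact 𝒢.Coherent.ι.projective_of_map_projective
      (restrictedYoneda.projective_of_map _ (P.prop_map_obj _ hX))
  · obtain ⟨_, π, ⟨X, hX, ⟨e⟩⟩, hπ⟩ := b.property.1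
    refine ⟨X, ObjectProperty.homMk (e.hom ≫ π), hX, 𝒢.Coherent.ι.epi_of_epi_map ?_⟩
    exact inferInstanceAs (Epi (e.hom ≫ π))

end IsProjectivelyGenerating

end

end ExactStructure

/-! ### Models in prescribed universes -/

namespace CategoryTheory.Abelian

/-- An abelian category is equivalent to an abelian category in prescribed universes as soon as
its morphisms and its isomorphism classes of objects fit into these universes. -/
lemma exists_equivalence {B : Type u} [Category.{v} B] [Abelian B] [LocallySmall.{w'} B]
    {I : Type w} (F : I → B) (hF : ∀ b, ∃ i, Nonempty (F i ≅ b)) :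
    ∃ (B' : Type w) (_ : Category.{w'} B') (_ : Abelian B'), Nonempty (B ≌ B') := by
  have : (inducedFunctor F).EssSurj := ⟨hF⟩
  have : (inducedFunctor F).IsEquivalence := { }
  let e := (inducedFunctor F).asEquivalence
  have : HasFiniteProducts (InducedCategory B F) :=
    ⟨fun n => Adjunction.hasLimitsOfShape_of_equivalence (inducedFunctor F)⟩
  let : Abelian (InducedCategory B F) := abelianOfEquivalence (inducedFunctor F)
  have : LocallySmall.{w'} (InducedCategory B F) := locallySmall_of_faithful (inducedFunctor F)
  exact ⟨ShrinkHoms (InducedCategory B F), inferInstance, inferInstance,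
    ⟨e.symm.trans (ShrinkHoms.equivalence _)⟩⟩

end CategoryTheory.Abelian

namespace ExactStructure

variable {E : Type u} [Category.{v} E] [Preadditive E] [HasZeroObject E] [HasBinaryBiproducts E]
  {S : ExactStructure E} {P : ObjectProperty E} {B : Type w} [Category.{w'} B] [Abelian B]
  {F : E ⥤ B}

namespace IsProjectiveEmbedding

variable (hF : S.IsProjectiveEmbedding P F)
include hF

/-- A morphism in the target is determined by, and lifts to, a morphism between objects of `P`, so
the morphisms fit into the universe of the morphisms of the exact category. -/
lemma locallySmall : LocallySmall.{v} B where
  hom_small X Y := by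
    obtain ⟨p, π, hp, _⟩ := hF.exists_epi X
    obtain ⟨q, ρ, hq, _⟩ := hF.exists_epi Y
    have := hF.projective p hp
    have hs : Function.Surjective fun f : p ⟶ q => F.map f ≫ ρ := fun g => by
      have := hF.full
      obtain ⟨t, ht⟩ := F.map_surjective (Projective.factorThru g ρ)
      exact ⟨t, by simp [ht]⟩
    have hi : Function.Injective fun f : X ⟶ Y => π ≫ f := fun f g h => (cancel_epi π).1 h
    have : Small.{v} (F.obj p ⟶ Y) := small_of_surjective hs
    exact small_of_injective hi

lemma exists_cokernel_iso (b : B) :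
    ∃ f : Arrow P.FullSubcategory, Nonempty (cokernel (F.map f.hom.hom) ≅ b) := by
  have := hF.full
  obtain ⟨p, π, hp, _⟩ := hF.exists_epi b
  obtain ⟨q, ρ, hq, _⟩ := hF.exists_epi (kernel π)
  obtain ⟨f, hf⟩ := F.map_surjective (ρ ≫ kernel.ι π)
  refine ⟨Arrow.mk (Y := ⟨p, hp⟩) (X := ⟨q, hq⟩) (ObjectProperty.homMk f),
    ⟨(cokernelIsCokernel _).coconePointUniqueUpToIso
      (isCokernelEpiComp (Abelian.epiIsCokernelOfKernel _ (kernelIsKernel π)) ρ hf)⟩⟩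

/-- The category generated by the projectives has a model in any universe that is large enough
for the exact category. -/
lemma exists_equivalence :
    ∃ (M : Type (max u v u')) (_ : Category.{max v v'} M) (_ : Abelian M), Nonempty (B ≌ M) := by
  have := hF.locallySmall
  have : LocallySmall.{max v v'} B := ⟨fun X Y => small_lift.{w', v', v} (X ⟶ Y)⟩
  exact Abelian.exists_equivalence
    (fun f : ULift.{u'} (Arrow P.FullSubcategory) => cokernel (F.map f.down.hom.hom))
    fun b => (hF.exists_cokernel_iso b).elim fun f hf => ⟨⟨f⟩, hf⟩

end IsProjectiveEmbedding

lemma IsProjectivelyGenerating.exists_isProjectiveEmbedding (hP : S.IsProjectivelyGenerating P)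
    [HasWeakKernels P.FullSubcategory] :
    ∃ (M : Type (max u v u')) (_ : Category.{max v v'} M) (_ : Abelian M) (R : E ⥤ M),
      S.IsProjectiveEmbedding P R := by
  obtain ⟨_, R, hR⟩ := hP.exists_isProjectiveEmbedding_of_hasWeakKernels
  obtain ⟨M, _, _, ⟨e⟩⟩ := IsProjectiveEmbedding.exists_equivalence.{_, _, _, v', _, u'} hR
  exact ⟨M, inferInstance, inferInstance, _, hR.comp_equivalence hP e⟩

end ExactStructure

/-! ### Extension of right exact functors along a projective embedding -/

namespace ExactStructure

variable {E : Type u} [Category.{v} E] [Preadditive E] [HasZeroObject E] [HasBinaryBiproducts E]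
  {S : ExactStructure E} {P : ObjectProperty E} {M : Type w} [Category.{w'} M] [Abelian M]
  {R : E ⥤ M}

variable (P R) in
/-- A presentation of an object `m` by objects of the subcategory `P`. -/
structure Presentation (m : M) where
  /-- the object of generators -/
  gen : E
  /-- the object of relations -/
  rel : E
  /-- the map from the relations to the generators -/
  d : rel ⟶ gen
  /-- the projection -/
  π : R.obj gen ⟶ m
  prop_gen : P gen
  prop_rel : P rel
  epi : Epi π
  zero : R.map d ≫ π = 0
  exact : (ShortComplex.mk _ _ zero).Exact

lemma IsProjectiveEmbedding.nonempty_presentation (hR : S.IsProjectiveEmbedding P R) (m : M) :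
    Nonempty (Presentation P R m) := by
  have := hR.full
  obtain ⟨p, π, hp, hπ⟩ := hR.exists_epi m
  obtain ⟨q, ρ, hq, _⟩ := hR.exists_epi (kernel π)
  obtain ⟨f, hf⟩ := R.map_surjective (ρ ≫ kernel.ι π)
  have hz : R.map f ≫ π = 0 := by simp [hf]
  refine ⟨p, q, f, π, hp, hq, hπ, hz, ?_⟩
  rw [ShortComplex.exact_iff_epi_kernel_lift]
  have : kernel.lift π (R.map f) hz = ρ := by
    rw [← cancel_mono (kernel.ι π), kernel.lift_ι, hf]
  dsimp
  rwa [this]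

namespace Presentation

attribute [instance] Presentation.epi

variable {m n : M} (X : Presentation P R m) (Y : Presentation P R n)

lemma exists_lift (hR : S.IsProjectiveEmbedding P R) {Q : E} (hQ : P Q) (y : R.obj Q ⟶ m) :
    ∃ a : Q ⟶ X.gen, R.map a ≫ X.π = y := by
  have := hR.full
  have := hR.projective Q hQ
  obtain ⟨a, ha⟩ := R.map_surjective (Projective.factorThru y X.π)
  exact ⟨a, by simp [ha]⟩

lemma exists_lift_zero (hR : S.IsProjectiveEmbedding P R) {Q : E} (hQ : P Q) (x : Q ⟶ X.gen)
    (hx : R.map x ≫ X.π = 0) : ∃ b : Q ⟶ X.rel, b ≫ X.d = x := by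
  have := hR.full
  have := hR.faithful
  have := hR.projective Q hQ
  obtain ⟨b, hb⟩ := R.map_surjective (X.exact.liftFromProjective (R.map x) hx)
  exact ⟨b, R.map_injective (by
    rw [R.map_comp, hb]
    exact X.exact.liftFromProjective_comp _ _)⟩

variable {A : Type u'} [Category.{v'} A] [Abelian A] (T : E ⥤ A)

/-- The cokernel of the image of a presentation under a functor `T`. -/
noncomputable abbrev coker : A := cokernel (T.map X.d)

variable (hR : S.IsProjectiveEmbedding P R)

include hR in
/-- Two morphisms to the generators that agree in `m` differ by a relation, hence agree in
`X.coker T`. -/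
lemma map_comp_π_eq [T.Additive] {Q : E} (hQ : P Q) {x x' : Q ⟶ X.gen}
    (h : R.map x ≫ X.π = R.map x' ≫ X.π) :
    T.map x ≫ cokernel.π (T.map X.d) = T.map x' ≫ cokernel.π (T.map X.d) := by
  have := hR.exact.additive
  obtain ⟨b, hb⟩ := X.exists_lift_zero hR hQ (x - x') (by
    rw [R.map_sub, Preadditive.sub_comp, h, sub_self])
  rw [← sub_eq_zero, ← Preadditive.sub_comp, ← T.map_sub, ← hb, T.map_comp, Category.assoc,
    cokernel.condition, comp_zero]

/-- The map `T Q ⟶ X.coker T` induced by a map `R Q ⟶ m`. -/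
noncomputable def ofMap {Q : E} (hQ : P Q) (y : R.obj Q ⟶ m) : T.obj Q ⟶ X.coker T :=
  T.map (X.exists_lift hR hQ y).choose ≫ cokernel.π _

variable [T.Additive]

lemma ofMap_map_comp {Q : E} (hQ : P Q) (x : Q ⟶ X.gen) :
    X.ofMap T hR hQ (R.map x ≫ X.π) = T.map x ≫ cokernel.π _ :=
  X.map_comp_π_eq T hR hQ (X.exists_lift hR hQ _).choose_spec

lemma ofMap_π : X.ofMap T hR X.prop_gen X.π = cokernel.π _ := by
  simpa using X.ofMap_map_comp T hR X.prop_gen (𝟙 _)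

lemma map_comp_ofMap {Q Q' : E} (hQ : P Q) (hQ' : P Q') (x : Q' ⟶ Q) (y : R.obj Q ⟶ m) :
    T.map x ≫ X.ofMap T hR hQ y = X.ofMap T hR hQ' (R.map x ≫ y) := by
  obtain ⟨a, rfl⟩ := X.exists_lift hR hQ y
  rw [← R.map_comp_assoc, ofMap_map_comp, ofMap_map_comp, T.map_comp_assoc]

lemma ofMap_add {Q : E} (hQ : P Q) (y z : R.obj Q ⟶ m) :
    X.ofMap T hR hQ (y + z) = X.ofMap T hR hQ y + X.ofMap T hR hQ z := by
  have := hR.exact.additive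
  obtain ⟨a, rfl⟩ := X.exists_lift hR hQ y
  obtain ⟨b, rfl⟩ := X.exists_lift hR hQ z
  rw [← Preadditive.add_comp, ← R.map_add]
  simp only [ofMap_map_comp, T.map_add, Preadditive.add_comp]

lemma ofMap_zero {Q : E} (hQ : P Q) : X.ofMap T hR hQ 0 = 0 := by
  simpa using X.ofMap_add T hR hQ 0 0

lemma ofMap_sub {Q : E} (hQ : P Q) (y z : R.obj Q ⟶ m) :
    X.ofMap T hR hQ (y - z) = X.ofMap T hR hQ y - X.ofMap T hR hQ z := by
  rw [eq_sub_iff_add_eq, ← ofMap_add, sub_add_cancel]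

/-- The map between cokernels induced by a map between the presented objects. -/
noncomputable def map (g : m ⟶ n) : X.coker T ⟶ Y.coker T :=
  cokernel.desc _ (Y.ofMap T hR X.prop_gen (X.π ≫ g)) (by
    rw [Y.map_comp_ofMap T hR X.prop_gen X.prop_rel, ← Category.assoc, X.zero, zero_comp,
      ofMap_zero])

lemma ofMap_comp_map {Q : E} (hQ : P Q) (y : R.obj Q ⟶ m) (g : m ⟶ n) :
    X.ofMap T hR hQ y ≫ X.map Y T hR g = Y.ofMap T hR hQ (y ≫ g) := by
  obtain ⟨a, rfl⟩ := X.exists_lift hR hQ y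
  rw [ofMap_map_comp, Category.assoc, map, cokernel.π_desc,
    Y.map_comp_ofMap T hR X.prop_gen hQ, Category.assoc]

variable {X T} in
lemma hom_ext {Z : A} {f g : X.coker T ⟶ Z}
    (h : X.ofMap T hR X.prop_gen X.π ≫ f = X.ofMap T hR X.prop_gen X.π ≫ g) : f = g := by
  rwa [ofMap_π, cancel_epi] at h

end Presentation

namespace IsProjectiveEmbedding

open Presentation

variable (hR : S.IsProjectiveEmbedding P R) {A : Type u'} [Category.{v'} A] [Abelian A]
  (T : E ⥤ A) [T.Additive]

/-- A choice of presentations by objects of `P`. -/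
noncomputable def presentation (m : M) : Presentation P R m := (hR.nonempty_presentation m).some

/-- The functor `M ⥤ A` that is defined by choosing presentations and applying `T` to them. -/
noncomputable def extension : M ⥤ A where
  obj m := (hR.presentation m).coker T
  map g := (hR.presentation _).map (hR.presentation _) T hR g
  map_id m := hom_ext hR (by simp [ofMap_comp_map])
  map_comp f g := hom_ext hR (by simp [ofMap_comp_map, reassoc_of% ofMap_comp_map])

/-- The map `T Q ⟶ (hR.extension T).obj m` induced by a map `R Q ⟶ m`. -/
noncomputable def toExtension {Q : E} (hQ : P Q) {m : M} (y : R.obj Q ⟶ m) :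
    T.obj Q ⟶ (hR.extension T).obj m :=
  (hR.presentation m).ofMap T hR hQ y

variable {m n : M}

lemma toExtension_map {Q : E} (hQ : P Q) (y : R.obj Q ⟶ m) (g : m ⟶ n) :
    hR.toExtension T hQ y ≫ (hR.extension T).map g = hR.toExtension T hQ (y ≫ g) :=
  ofMap_comp_map _ _ T hR hQ y g

lemma map_toExtension {Q Q' : E} (hQ : P Q) (hQ' : P Q') (x : Q' ⟶ Q) (y : R.obj Q ⟶ m) :
    T.map x ≫ hR.toExtension T hQ y = hR.toExtension T hQ' (R.map x ≫ y) :=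
  map_comp_ofMap _ T hR hQ hQ' x y

lemma toExtension_add {Q : E} (hQ : P Q) (y z : R.obj Q ⟶ m) :
    hR.toExtension T hQ (y + z) = hR.toExtension T hQ y + hR.toExtension T hQ z :=
  ofMap_add _ T hR hQ y z

lemma toExtension_sub {Q : E} (hQ : P Q) (y z : R.obj Q ⟶ m) :
    hR.toExtension T hQ (y - z) = hR.toExtension T hQ y - hR.toExtension T hQ z :=
  ofMap_sub _ T hR hQ y z

lemma toExtension_eq_π :
    hR.toExtension T (hR.presentation m).prop_gen (hR.presentation m).π = cokernel.π _ :=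
  ofMap_π _ T hR

instance : Epi (hR.toExtension T (hR.presentation m).prop_gen (hR.presentation m).π) := by
  rw [toExtension_eq_π]
  exact inferInstanceAs (Epi (cokernel.π _))

/-- The map from the generators of a presentation to the extension is a cokernel of the map from the
relations. -/
noncomputable def isColimitToExtension :
    IsColimit (CokernelCofork.ofπ (f := T.map (hR.presentation m).d)
      (hR.toExtension T (hR.presentation m).prop_gen (hR.presentation m).π) (by
        rw [toExtension_eq_π]; exact cokernel.condition _)) :=
  IsColimit.ofIsoColimit (cokernelIsCokernel (T.map (hR.presentation m).d))
    (Cofork.ext (Iso.refl _) ((Category.comp_id _).trans (hR.toExtension_eq_π T).symm))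

instance : (hR.extension T).Additive where
  map_add {m _ _ _} := by
    rw [← cancel_epi (hR.toExtension T (hR.presentation m).prop_gen (hR.presentation m).π)]
    simp only [toExtension_map, Preadditive.comp_add, toExtension_add]

/-- The extension is right exact: if `U` is short exact, the map `R Q ⟶ U.X₃` of a presentation
lifts to a map `y` to `U.X₂`, and `y` provides the factorizations through `U.X₃` of the morphisms
that vanish on `U.X₁`. -/
lemma isRightExact_extension : (ofAbelian M).IsRightExact (hR.extension T) := by
  have key : ∀ U : ShortComplex M, U.ShortExact → Epi ((hR.extension T).map U.g) ∧
      (U.map (hR.extension T)).Exact := by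
    intro U hU
    have := hU.epi_g
    have := hU.mono_f
    let H := hR.extension T
    have hp := (hR.presentation U.X₃).prop_gen
    have := hR.projective _ hp
    -- the projection onto `U.X₃` lifts along the epimorphism `U.g`
    let y : R.obj (hR.presentation U.X₃).gen ⟶ U.X₂ :=
      Projective.factorThru (hR.presentation U.X₃).π U.g
    have hy : y ≫ U.g = (hR.presentation U.X₃).π := Projective.factorThru_comp _ _
    have hepi : Epi (H.map U.g) := by
      have h := hR.toExtension_map T hp y U.g
      rw [hy] at h
      have : Epi (hR.toExtension T hp y ≫ H.map U.g) := by rw [h]; infer_instance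
      exact epi_of_epi (hR.toExtension T hp y) _
    refine ⟨hepi, ?_⟩
    have hzero {Q : E} (hQ : P Q) (z : R.obj Q ⟶ U.X₂) (hz : z ≫ U.g = 0) {Z : A}
        (k : H.obj U.X₂ ⟶ Z) (hk : H.map U.f ≫ k = 0) : hR.toExtension T hQ z ≫ k = 0 := by
      have hl : hU.exact.lift z hz ≫ U.f = z := hU.exact.lift_f z hz
      rw [← hl, ← toExtension_map, Category.assoc, hk, comp_zero]
    have w : H.map U.f ≫ H.map U.g = 0 := by rw [← H.map_comp, U.zero, H.map_zero]
    have hcol : IsColimit (CokernelCofork.ofπ (H.map U.g) w) :=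
      CokernelCofork.IsColimit.ofπ' _ _ fun {Z} k hk => by
        obtain ⟨l, hl⟩ := CokernelCofork.IsColimit.desc' (hR.isColimitToExtension T (m := U.X₃))
          (hR.toExtension T hp y ≫ k) (by
            rw [← Category.assoc, map_toExtension _ _ hp (hR.presentation U.X₃).prop_rel]
            exact hzero _ _ (by rw [Category.assoc, hy, (hR.presentation U.X₃).zero]) k hk)
        replace hl : hR.toExtension T hp (hR.presentation U.X₃).π ≫ l =
          hR.toExtension T hp y ≫ k := hl
        refine ⟨l, ?_⟩
        have hq := (hR.presentation U.X₂).prop_gen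
        obtain ⟨b, hb⟩ := (hR.presentation U.X₃).exists_lift hR hq
          ((hR.presentation U.X₂).π ≫ U.g)
        rw [← cancel_epi (hR.toExtension T hq (hR.presentation U.X₂).π), ← Category.assoc,
          toExtension_map, ← hb, ← map_toExtension _ _ hp hq, Category.assoc, hl,
          ← Category.assoc, map_toExtension _ _ hp hq, ← sub_eq_zero, ← Preadditive.sub_comp,
          ← toExtension_sub]
        exact hzero _ _ (by rw [Preadditive.sub_comp, Category.assoc, hy, hb, sub_self]) k hk
    exact ShortComplex.exact_of_g_is_cokernel _ hcol
  exact
    { additive := inferInstance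
      exact := fun U hU => (key U hU).2
      epi := fun U hU => (key U hU).1 }

end IsProjectiveEmbedding

end ExactStructure

namespace ExactStructure

section

variable {E : Type u} [Category.{v} E] [Preadditive E] [HasZeroObject E] [HasBinaryBiproducts E]
  {S : ExactStructure E} {P : ObjectProperty E} {M : Type w} [Category.{w'} M] [Abelian M]
  {R : E ⥤ M} {A : Type u'} [Category.{v'} A] [Abelian A] {T : E ⥤ A}

namespace IsProjectiveEmbedding

variable (hR : S.IsProjectiveEmbedding P R) (hE : IsWeaklyIdempotentSplit E)
  (hP : S.IsProjectivelyGenerating P) (hT : S.IsRightExact T)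

include hR hE hP hT

/-- A right exact functor preserves those cokernels that are cokernels after applying `R`. -/
lemma isColimit_map {X Y Z : E} (f : X ⟶ Y) (g : Y ⟶ Z) (w : f ≫ g = 0) [Epi (R.map g)]
    (h : ∀ w, (ShortComplex.mk (R.map f) (R.map g) w).Exact) (w' : T.map f ≫ T.map g = 0) :
    Nonempty (IsColimit (CokernelCofork.ofπ (T.map g) w')) := by
  have := hT.additive
  have := hR.exact.additive
  obtain ⟨K, i, wi, hi⟩ := hR.isDeflation hE hP g inferInstance
  obtain ⟨k, hk⟩ : ∃ k, k ≫ i = f := by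
    obtain ⟨k, hk⟩ := KernelFork.IsLimit.lift' (S.isKernel hi).some f w
    exact ⟨k, hk⟩
  have hepi : Epi (R.map k) := by
    have : Mono (R.map i) := (hR.exact.map_conflation _ hi).mono_f
    have hex := (ShortComplex.exact_iff_exact_up_to_refinements _).1
      (h (by rw [← R.map_comp, w, R.map_zero]))
    obtain ⟨Q, π, _, t, ht⟩ : ∃ (Q : M) (π : Q ⟶ R.obj K) (_ : Epi π) (t : Q ⟶ R.obj X),
        π ≫ R.map i = t ≫ R.map f := hex (R.map i) (by
      dsimp
      rw [← R.map_comp, wi, R.map_zero])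
    have : t ≫ R.map k = π := by
      rw [← cancel_mono (R.map i), Category.assoc, ← R.map_comp, hk, ← ht]
    have : Epi (t ≫ R.map k) := by rwa [this]
    exact epi_of_epi t _
  obtain ⟨_, _, _, hk'⟩ := hR.isDeflation hE hP k hepi
  have : Epi (T.map k) := hT.epi _ hk'
  have : Epi ((ShortComplex.mk i g wi).map T).g := hT.epi _ hi
  have hcol : IsColimit (CokernelCofork.ofπ (f := T.map i) (T.map g) _) :=
    (hT.exact _ hi).gIsCokernel
  exact ⟨isCokernelEpiComp hcol (T.map k) (by rw [← T.map_comp, hk])⟩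

/-- The extension of `T` agrees with `T` on the exact category. The isomorphism is characterized by
its compatibility with the maps `toExtension`, which makes it natural. -/
lemma exists_iso_obj [T.Additive] (X : E) :
    ∃ e : (hR.extension T).obj (R.obj X) ≅ T.obj X,
      ∀ (Q : E) (hQ : P Q) (z : Q ⟶ X), hR.toExtension T hQ (R.map z) ≫ e.hom = T.map z := by
  have := hR.full
  have := hR.faithful
  have := hR.exact.additive
  let Y := hR.presentation (R.obj X)
  obtain ⟨x, hx⟩ := R.map_surjective Y.π
  have : Epi (R.map x) := by rw [hx]; infer_instance
  have w : Y.d ≫ x = 0 := R.map_injective (by rw [R.map_comp, hx, Y.zero, R.map_zero])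
  obtain ⟨hcol⟩ := hR.isColimit_map hE hP hT Y.d x w
    (fun w => by simpa only [hx] using Y.exact) (by rw [← T.map_comp, w, T.map_zero])
  let e := (hR.isColimitToExtension T (m := R.obj X)).coconePointUniqueUpToIso hcol
  have he : hR.toExtension T Y.prop_gen Y.π ≫ e.hom = T.map x :=
    (hR.isColimitToExtension T).comp_coconePointUniqueUpToIso_hom hcol WalkingParallelPair.one
  refine ⟨e, fun Q hQ z => ?_⟩
  obtain ⟨a, ha⟩ := Y.exists_lift hR hQ (R.map z)
  rw [← ha, ← map_toExtension _ _ Y.prop_gen, Category.assoc, he, ← T.map_comp]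
  congr 1
  exact R.map_injective (by rw [R.map_comp, hx, ha])

lemma exists_extension :
    ∃ (H : M ⥤ A) (_ : (ofAbelian M).IsRightExact H), Nonempty (R ⋙ H ≅ T) := by
  have := hT.additive
  refine ⟨hR.extension T, hR.isRightExact_extension T, ?_⟩
  choose e he using hR.exists_iso_obj hE hP hT
  refine ⟨NatIso.ofComponents e fun {X Y} f => ?_⟩
  have := hR.full
  obtain ⟨x, hx⟩ := R.map_surjective (hR.presentation (R.obj X)).π
  rw [← cancel_epi (hR.toExtension T (hR.presentation (R.obj X)).prop_gen (hR.presentation _).π),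
    ← hx, reassoc_of% he]
  dsimp
  rw [← Category.assoc, toExtension_map, ← R.map_comp, he, T.map_comp]

end IsProjectiveEmbedding

end

/-! ### The right abelian envelope -/

section

variable {E : Type u} [Category.{v} E] [Preadditive E] [HasZeroObject E] [HasBinaryBiproducts E]
  {S : ExactStructure E} {P : ObjectProperty E} {A : Type u'} [Category.{v'} A] [Abelian A]
  {iR : E ⥤ A}

lemma isRightExact_of_preservesFiniteColimits {B : Type w} [Category.{w'} B] [Abelian B]
    (F : A ⥤ B) [F.Additive] [PreservesFiniteColimits F] : (ofAbelian A).IsRightExact F := by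
  have h : ∀ T : ShortComplex A, T.ShortExact → (T.map F).Exact ∧ Epi (F.map T.g) :=
    ((Functor.preservesFiniteColimits_tfae F).out 0 3).2 ‹PreservesFiniteColimits F›
  exact
    { additive := inferInstance
      exact := fun T hT => (h T hT).1
      epi := fun T hT => (h T hT).2 }

lemma IsRightExact.map_epi {B : Type w} [Category.{w'} B] [Abelian B] {F : A ⥤ B}
    (hF : (ofAbelian A).IsRightExact F) {X Y : A} (f : X ⟶ Y) [Epi f] : Epi (F.map f) :=
  hF.epi (ShortComplex.mk (kernel.ι f) f (kernel.condition f))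
    { exact := ShortComplex.exact_kernel f
      mono_f := inferInstanceAs (Mono (kernel.ι f))
      epi_g := inferInstanceAs (Epi f) }

/-- A right exact endofunctor of the envelope that restricts to the identity is the identity. The
envelope need not live in the universes in which its universal property is available, whence the
detour through an equivalent category that does. -/
lemma IsRightAbelianEnvelope.nonempty_iso
    (hA : IsRightAbelianEnvelope.{max u v u', max v v'} S iR)
    {F : A ⥤ A} (hF : (ofAbelian A).IsRightExact F) (e : iR ⋙ F ≅ iR) : Nonempty (F ≅ 𝟭 A) := by
  have : LocallySmall.{max v v'} A := locallySmall_max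
  obtain ⟨A', _, _, ⟨ε⟩⟩ := Abelian.exists_equivalence.{max u v u', max v v'} (B := A)
    (fun a : ULift.{max u v} A => a.down) fun a => ⟨⟨a⟩, ⟨Iso.refl _⟩⟩
  have : ε.functor.Additive := ε.functor.additive_of_preserves_binary_products
  have hε : (ofAbelian A).IsRightExact ε.functor :=
    isRightExact_of_preservesFiniteColimits ε.functor
  have := hA.isEquivalence A'
  let Φ := Rex.precomp S iR hA.isRightExact A'
  let X : (ofAbelian A).Rex A' := ⟨F ⋙ ε.functor, hF.comp hε⟩
  let Y : (ofAbelian A).Rex A' := ⟨ε.functor, hε⟩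
  let i : Φ.obj X ≅ Φ.obj Y :=
    (ObjectProperty.ι _).preimageIso (Functor.isoWhiskerRight e ε.functor)
  let j : F ⋙ ε.functor ≅ ε.functor := (ObjectProperty.ι _).mapIso (Φ.preimageIso i)
  exact ⟨(Functor.isoWhiskerLeft F ε.unitIso) ≪≫ Functor.isoWhiskerRight j ε.inverse ≪≫
    ε.unitIso.symm⟩

/-- The right abelian envelope embeds the exact category into an abelian category in which the
objects of `P` become enough projectives. With `R : E ⥤ M` the embedding into coherent functors,
`iR` extends to `H : M ⥤ A` and `R` extends to `G : A ⥤ M`; then `G ⋙ H` is the identity, and this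
suffices to transport the properties of `R` to `iR`. -/
lemma IsRightAbelianEnvelope.isProjectiveEmbedding
    (hA : IsRightAbelianEnvelope.{max u v u', max v v'} S iR)
    (hE : IsWeaklyIdempotentSplit E) (hP : S.IsProjectivelyGenerating P)
    [HasWeakKernels P.FullSubcategory] : S.IsProjectiveEmbedding P iR := by
  obtain ⟨M, _, _, R, hR⟩ := IsProjectivelyGenerating.exists_isProjectiveEmbedding.{v, v', u, u'} hP
  obtain ⟨H, hH, ⟨eH⟩⟩ := hR.exists_extension hE hP hA.isRightExact
  have := hR.full
  have := hR.faithful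
  have := hR.exact.additive
  have := hA.isRightExact.additive
  have hR' : S.IsRightExact R :=
    { additive := inferInstance
      exact := fun T hT => (hR.exact.map_conflation T hT).exact
      epi := fun T hT => (hR.exact.map_conflation T hT).epi_g }
  obtain ⟨G, hG, ⟨eG⟩⟩ : ∃ G : A ⥤ M, (ofAbelian A).IsRightExact G ∧ Nonempty (iR ⋙ G ≅ R) := by
    have := hA.isEquivalence M
    let Φ := Rex.precomp S iR hA.isRightExact M
    let Y : S.Rex M := ⟨R, hR'⟩
    exact ⟨(Φ.objPreimage Y).obj, (Φ.objPreimage Y).property,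
      ⟨(ObjectProperty.ι _).mapIso (Φ.objObjPreimageIso Y)⟩⟩
  obtain ⟨η⟩ := hA.nonempty_iso (hG.comp hH) (Functor.isoWhiskerRight eG H ≪≫ eH)
  have : (G ⋙ H).Faithful := .of_iso η.symm
  have : G.Faithful := .of_comp G H
  have : (iR ⋙ G).Faithful := .of_iso eG.symm
  have : (iR ⋙ G).Full := .of_iso eG.symm
  have : iR.Faithful := .of_comp iR G
  have : iR.Full := .of_comp_faithful iR G
  refine hP.isProjectiveEmbedding iR (fun X hX => ?_) fun a => ?_
  · have : Projective (G.obj (iR.obj X)) := Projective.of_iso (eG.symm.app X) (hR.projective X hX)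
    refine ⟨fun {Y Z} t f _ => ?_⟩
    have := hG.map_epi f
    refine ⟨η.inv.app _ ≫ H.map (Projective.factorThru (G.map t) (G.map f)) ≫ η.hom.app _, ?_⟩
    have h := η.hom.naturality f
    have h' := η.inv.naturality t
    dsimp at h h'
    rw [Category.assoc, Category.assoc, ← h, ← H.map_comp_assoc, Projective.factorThru_comp,
      ← reassoc_of% h', Iso.inv_hom_id_app]
    exact Category.comp_id _
  · obtain ⟨X, π, hX, _⟩ := hR.exists_epi (G.obj a)
    have := hH.map_epi π
    exact ⟨X, eH.inv.app X ≫ H.map π ≫ η.hom.app a, hX, inferInstance⟩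

end

end ExactStructure

theorem mainTheorem12 {E : Type u} [Category.{v} E] [Preadditive E] [HasZeroObject E]
    [HasBinaryBiproducts E] (S : ExactStructure E) (hE : IsWeaklyIdempotentSplit E)
    (P : ObjectProperty E) (hP : S.IsProjectivelyGenerating P)
    (hker : HasWeakKernels P.FullSubcategory)
    {A : Type u'} [Category.{v'} A] [Abelian A] (iR : E ⥤ A)
    (hA : ExactStructure.IsRightAbelianEnvelope.{max u v u', max v v'} S iR) :
    ∃ h : S.IsExactFunctor (ExactStructure.ofAbelian A) iR,
      h.mapBoundedAboveDerivedCategory.IsEquivalence ∧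
      (IsIdempotentComplete P.FullSubcategory → HasFiniteGlobalDimension A →
        h.mapBoundedDerivedCategory.IsEquivalence) := by
  have hF := hA.isProjectiveEmbedding hE hP
  exact ⟨hF.exact, hF.mapBoundedAboveDerivedCategory_isEquivalence hE hP,
    fun hidem hdim => hF.mapBoundedDerivedCategory_isEquivalence hE hP hidem hdim⟩
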